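/- **Setup.** Let $c=6.6\,e$, $h(x)=\frac{2}{\ln\ln c}\,\ln\frac{c}{x}\,\bigl(\ln\ln\frac{c}{x}\bigr)^2$ for $x\in(0,1]$, and let $F(\beta)=\frac{1}{|\beta|\,h(|\beta|)}$, $0<|\beta|\le 1$, which is a probability density on $[-1,1]$. For $x_1,x_2,\dots\in[0,1]$, $t\ge1$ and $m\in[0,1]$ put $$W_t(m,\beta)=\prod_{i=1}^t(1+\beta(x_i-m)),\qquad \mathrm{Wealth}_t(m)=\int_{-1}^1 W_t(m,\beta)F(\beta)\,d\beta,$$ $$W^*_t(m)=\max_{\beta\in[-1,1]}W_t(m,\beta),\qquad \beta^*_t(m)\in\operatorname*{argmax}_{\beta\in[-1,1]}W_t(m,\beta),$$ $q_t(m)=\min_{i\le t}(x_i-m)\,\mathrm{sign}(\beta^*_t(m))$, $V_t(m)=\sum_{i=1}^t(x_i-m)^2$, $d_t(m)=1+\min(q_t(m)|\beta^*_t(m)|,0)$; $\tilde\Delta_t(m)=d_t(m)/\sqrt{V_t(m)}$ if $|\beta^*_t(m)|<1$ and $\tilde\Delta_t(m)=0$ if $|\beta^*_t(m)|=1$; $\Delta_t(m)=|\beta^*_t(m)|-\max(|\beta^*_t(m)|-\tilde\Delta_t(m),0)$;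 and $$R_t(m)=\left[\max\left(\frac{1-1/W^*_t(m)}{\ln W^*_t(m)}\,|\beta^*_t(m)|,\ \exp\Bigl(-\frac{\Delta_t(m)^2V_t(m)}{2d_t(m)^2}\Bigr)\Delta_t(m)\right)F(\beta^*_t(m))\right]^{-1},$$ where $\frac{1-1/w}{\ln w}$ is read as $1$ at $w=1$, and $R_t(m)=\infty$ if $\beta^*_t(m)=0$. Let $\hat\mu_t=\frac1t\sum_{i=1}^tx_i$. For $\delta\in(0,1)$ let $m_{\ell,t}$ be the smallest $m\in[0,\hat\mu_t]$ and $m_{u,t}$ the largest $m\in[\hat\mu_t,1]$ with $W^*_t(m)\le R_t(m)/\delta$ (infimum and supremum), and let $\ell_0=0$, $u_0=1$, $\ell_t=\max(m_{\ell,t},\ell_{t-1})$, $u_t=\min(m_{u,t},u_{t-1})$. Finally let $V_t=\sum_{i=1}^t(x_i-\hat\mu_t)^2$ and $$U_t=-\tfrac12W_{-1}\left(-\frac{2}{\bigl(\frac{20}{3\delta}\,h\bigl(\frac{1}{2+\sqrt{V_t/2}}\bigr)\bigr)^2}\right),$$ where $W_{-1}$ is the negative branch of the Lambert function ($W_{-1}(y)$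 is the $w\le-1$ with $we^w=y$, for $y\in[-1/e,0)$). **Theorem.** 1. (Regret) For all $x_1,x_2,\dots\in[0,1]$, $t\ge1$ and $m\in[0,1]$: $\ \ln W^*_t(m)-\ln\mathrm{Wealth}_t(m)\le\ln R_t(m)$. 2. (Confidence sequence) Let $\delta\in(0,1)$ and let $X_1,X_2,\dots$ be random variables with $0\le X_i\le1$ almost surely and $\mathbb E[X_i\mid X_1,\dots,X_{i-1}]=\mu$ for all $i$. Then, for $\ell_t,u_t$ computed from $X_1,X_2,\dots$, with probability at least $1-\delta$ we have $\mu\in[\ell_t,u_t]$ for all $t\ge1$. 3. (Width) For all $\delta\in(0,1)$, $x_1,x_2,\dots\in[0,1]$ and $t\ge1$ with $t>2U_t$, both $u_t-\hat\mu_t$ and $\hat\mu_t-\ell_t$ are at most $$\frac1t\sqrt{\max\left(\frac{U_t}{1-2U_t/t},1\right)2V_t}+\frac{\frac43U_t}{t-2U_t}+\frac{24}{t}\ln\frac{7}{6\delta}.$$ 4. $U_t=O\bigl(\ln\frac{\ln^3t}{\delta}\bigr)$: there are constants $K$ and $t_0$, independent of $\delta\in(0,1)$ and of $x_1,x_2,\dots\in[0,1]$,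 such that $|U_t|\le K\ln\frac{\ln^3t}{\delta}$ for all $t\ge t_0$. 5. (Law of the iterated logarithm) For every $\delta\in(0,1)$ there is a sequence $\varepsilon_t=o\bigl(\sqrt{\ln\ln t/t}\bigr)$, $t\to\infty$, such that for all $x_1,x_2,\dots\in[0,1]$ and $t\ge1$ both $u_t-\hat\mu_t$ and $\hat\mu_t-\ell_t$ are at most $\frac{1}{t}\sqrt{2V_t\ln\frac{\ln V_t}{\delta}}+\varepsilon_t$, where the first term is read as $0$ if $V_t\le e$. -/

import Mathlib

open MeasureTheory Filter Asymptotics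
open scoped ENNReal

noncomputable section

namespace PreciseR70

/-! Samples are sequences `x : ℕ → ℝ`; the first `t` samples are `x 0, …, x (t - 1)`. -/

/-- The constant `c = 6.6 e`. -/
def c : ℝ := 6.6 * Real.exp 1

/-- `h(x) = (2 / ln ln c) · ln (c / x) · (ln ln (c / x))²`, for `x ∈ (0, 1]`. -/
def h (x : ℝ) : ℝ :=
  2 / Real.log (Real.log c) * Real.log (c / x) * Real.log (Real.log (c / x)) ^ 2

/-- The prior density `F(β) = 1 / (|β| h(|β|))` on `[-1, 1]` (the value at the single point
`β = 0`, where the density is infinite, plays no role). -/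
def F (β : ℝ) : ℝ := 1 / (|β| * h |β|)

/-- Wealth of the constant betting fraction `β` after `t` rounds, on the coins `x i - m`. -/
def wealth (x : ℕ → ℝ) (t : ℕ) (m β : ℝ) : ℝ :=
  ∏ i ∈ Finset.range t, (1 + β * (x i - m))

/-- Wealth of the mixture strategy with prior density `F`. -/
def mixtureWealth (x : ℕ → ℝ) (t : ℕ) (m : ℝ) : ℝ :=
  ∫ β in (-1 : ℝ)..1, wealth x t m β * F β

theorem exists_best (x : ℕ → ℝ) (t : ℕ) (m : ℝ) :
    ∃ β ∈ Set.Icc (-1 : ℝ) 1, IsMaxOn (wealth x t m) (Set.Icc (-1) 1) β :=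
  isCompact_Icc.exists_isMaxOn ⟨0, by norm_num⟩
    (by unfold wealth; fun_prop)

/-- `β*_t(m)`, a maximizer over `[-1, 1]` of the wealth of constant fractions. It is unique when
`m ∈ [0, 1]` and the samples lie in `[0, 1]`, unless `x i = m` for all `i < t` (then the wealth
is constantly `1`, and the choice is arbitrary). -/
def betaStar (x : ℕ → ℝ) (t : ℕ) (m : ℝ) : ℝ := (exists_best x t m).choose

/-- `Wealth*_t(m)`, the maximal wealth over constant betting fractions in `[-1, 1]`. -/
def wealthStar (x : ℕ → ℝ) (t : ℕ) (m : ℝ) : ℝ := wealth x t m (betaStar x t m)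

/-- Regret of the mixture strategy against the best constant betting fraction in `[-1, 1]`. -/
def regret (x : ℕ → ℝ) (t : ℕ) (m : ℝ) : ℝ :=
  Real.log (wealthStar x t m) - Real.log (mixtureWealth x t m)

/-- `q_t(m) = min_i (x_i - m) sign(β*_t(m))`. -/
def q (x : ℕ → ℝ) (t : ℕ) (m : ℝ) : ℝ :=
  ⨅ i : Fin t, (x i - m) * Real.sign (betaStar x t m)

/-- `V_t(m) = ∑ (x_i - m)²`. -/
def V (x : ℕ → ℝ) (t : ℕ) (m : ℝ) : ℝ := ∑ i ∈ Finset.range t, (x i - m) ^ 2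

/-- `1 + min (q_t(m) |β*_t(m)|, 0)`. -/
def d (x : ℕ → ℝ) (t : ℕ) (m : ℝ) : ℝ := 1 + min (q x t m * |betaStar x t m|) 0

def deltaTilde (x : ℕ → ℝ) (t : ℕ) (m : ℝ) : ℝ :=
  if |betaStar x t m| < 1 then d x t m / √(V x t m) else 0

def Delta (x : ℕ → ℝ) (t : ℕ) (m : ℝ) : ℝ :=
  |betaStar x t m| - max (|betaStar x t m| - deltaTilde x t m) 0

/-- `(1 - 1/w) / ln w`, extended by continuity to `1` at `w = 1`. -/
def logRatio (w : ℝ) : ℝ := if w = 1 then 1 else (1 - 1 / w) / Real.log w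

/-- The regret bound `R_t(m)` on the multiplicative scale,
`1 / (max ((1 - 1/W*) / ln W* · |β*|, exp (-Δ² V / (2 d²)) · Δ) · F(β*))`,
with values in `[0, ∞]`; it is `∞` when `β*_t(m) = 0`. -/
def R (x : ℕ → ℝ) (t : ℕ) (m : ℝ) : ℝ≥0∞ :=
  1 / ENNReal.ofReal
    (max (logRatio (wealthStar x t m) * |betaStar x t m|)
        (Real.exp (-(Delta x t m ^ 2 * V x t m) / (2 * d x t m ^ 2)) * Delta x t m)
      * F (betaStar x t m))

/-- Empirical mean of the first `t` samples. -/
def muHat (x : ℕ → ℝ) (t : ℕ) : ℝ := (∑ i ∈ Finset.range t, x i) / t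

/-- The values `m` that are not rejected at time `t`: `Wealth*_t(m) ≤ R_t(m) / δ`. -/
def accepted (δ : ℝ) (x : ℕ → ℝ) (t : ℕ) : Set ℝ :=
  {m | ENNReal.ofReal (wealthStar x t m) ≤ R x t m / ENNReal.ofReal δ}

/-- The smallest accepted `m` in `[0, muHat]` (`muHat` itself is always accepted). -/
def mLow (δ : ℝ) (x : ℕ → ℝ) (t : ℕ) : ℝ :=
  sInf (Set.Icc 0 (muHat x t) ∩ accepted δ x t)

/-- The largest accepted `m` in `[muHat, 1]`. -/
def mUp (δ : ℝ) (x : ℕ → ℝ) (t : ℕ) : ℝ :=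
  sSup (Set.Icc (muHat x t) 1 ∩ accepted δ x t)

/-- Lower end of the confidence set, `ℓ_t = max (m_ℓ, ℓ_{t-1})`, `ℓ_0 = 0`. -/
def lower (δ : ℝ) (x : ℕ → ℝ) : ℕ → ℝ
  | 0 => 0
  | t + 1 => max (mLow δ x (t + 1)) (lower δ x t)

/-- Upper end of the confidence set, `u_t = min (m_u, u_{t-1})`, `u_0 = 1`. -/
def upper (δ : ℝ) (x : ℕ → ℝ) : ℕ → ℝ
  | 0 => 1
  | t + 1 => min (mUp δ x (t + 1)) (upper δ x t)

/-- The negative branch `W₋₁` of the Lambert function: for `y ∈ [-1/e, 0)`, the set below is the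
singleton of the unique `w ≤ -1` with `w eʷ = y`. -/
def lambertWm1 (y : ℝ) : ℝ := sInf {w : ℝ | w ≤ -1 ∧ w * Real.exp w = y}

/-- Empirical sum of squares `V_t = ∑ (x_i - muHat_t)²`. -/
def VHat (x : ℕ → ℝ) (t : ℕ) : ℝ := V x t (muHat x t)

/-- `U_t = -½ W₋₁(-2 / ((20 / (3δ)) h(1 / (2 + √(V_t / 2))))²)`. -/
def U (δ : ℝ) (x : ℕ → ℝ) (t : ℕ) : ℝ :=
  -(1 / 2) * lambertWm1 (-2 / (20 / (3 * δ) * h (1 / (2 + √(VHat x t / 2)))) ^ 2)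

/-- The explicit half-width bound; it is meaningful for `t > 2 U_t`. -/
def widthBound (δ : ℝ) (x : ℕ → ℝ) (t : ℕ) : ℝ :=
  1 / t * √(max (U δ x t / (1 - 2 * U δ x t / t)) 1 * (2 * VHat x t))
    + (4 / 3 * U δ x t) / (t - 2 * U δ x t)
    + 24 / t * Real.log (7 / (6 * δ))

/-- The leading term `√(2 V_t ln (ln V_t / δ)) / t`, read as `0` when `V_t ≤ e`. -/
def lilWidth (δ : ℝ) (x : ℕ → ℝ) (t : ℕ) : ℝ :=
  if Real.exp 1 < VHat x t then
    √(2 * VHat x t * Real.log (Real.log (VHat x t) / δ)) / t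
  else 0

end PreciseR70

end

/-!
Let `L = log W*_t(m)`. The prior `F` decreases on `(0, 1]`; after reflecting the coins so that
`β* > 0`, the mixture wealth is at least `F β*` times the integral of the wealth over any
`[l, β*]`. Bernoulli's inequality gives `W (r β*) ≥ W (β*) ^ r`, whence the first term of `R`, and
a second-order expansion of the log wealth at its maximiser gives a Gaussian lower bound, whence
the second term. At the true mean the mixture wealth is a nonnegative martingale started at `1`,
so Ville's maximal inequality turns the regret bound into coverage.

For the width, a Bennett-type choice of `β` yields `L ≥ S² / (2 (V + 2 S / 3))` with
`S = t |μ̂ - m|`. Conversely, acceptance of `m` forces `exp L ≤ K √L` with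
`K = (20 / (3 δ)) h (1 / (2 + √(V_t / 2)))`, that is, `L ≤ U_t`, unless the best bet is large and
`L ≥ 17`. In that case acceptance gives `L ≤ 2 log (1 / δ)`, while `S` is of order `L`; this
produces the term `24 log (7 / (6 δ))`.
-/

namespace PreciseR70

open Real Set

/-! ### Elementary inequalities -/

section Elementary

theorem le_of_hasDerivAt_le {f f' g g' : ℝ → ℝ} {a b : ℝ} (hab : a ≤ b)
    (hf : ∀ z ∈ Icc a b, HasDerivAt f (f' z) z) (hg : ∀ z ∈ Icc a b, HasDerivAt g (g' z) z)
    (ha : f a ≤ g a) (hle : ∀ z ∈ Ico a b, f' z ≤ g' z) : f b ≤ g b :=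
  image_le_of_deriv_right_le_deriv_boundary
    (fun z hz => (hf z hz).continuousAt.continuousWithinAt)
    (fun z hz => (hf z (Ico_subset_Icc_self hz)).hasDerivWithinAt) ha
    (fun z hz => (hg z hz).continuousAt.continuousWithinAt)
    (fun z hz => (hg z (Ico_subset_Icc_self hz)).hasDerivWithinAt) hle (right_mem_Icc.2 hab)

theorem exp_le_taylor_pow {x : ℝ} {k n : ℕ} (hk : 0 < k) (hn : 0 < n) (hx0 : 0 ≤ x)
    (hxk : x ≤ k) :
    exp x ≤ (∑ m ∈ Finset.range n, (x / k) ^ m / m.factorial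
      + (x / k) ^ n * (n + 1) / (n.factorial * n)) ^ k := by
  have hk' : (0 : ℝ) < k := Nat.cast_pos.2 hk
  calc exp x = exp (x / k) ^ k := by rw [← exp_nat_mul, mul_div_cancel₀ x hk'.ne']
    _ ≤ _ := by
        gcongr
        exact exp_bound' (by positivity) ((div_le_one hk').2 hxk) hn

theorem log_sub_log_lt {u v : ℝ} (hu : 1 ≤ u) (huv : u < v) : log v - log u < v - u := by
  have hu0 : 0 < u := by linarith
  have hne : v / u ≠ 1 := by rw [ne_eq, div_eq_one_iff_eq hu0.ne']; exact huv.ne'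
  calc log v - log u = log (v / u) := (log_div (by linarith) hu0.ne').symm
    _ < v / u - 1 := log_lt_sub_one_of_pos (div_pos (by linarith) hu0) hne
    _ = (v - u) / u := div_sub_one hu0.ne'
    _ ≤ v - u := div_le_self (by linarith) hu

theorem half_sub_inv_le_log {s : ℝ} (hs0 : 0 < s) (hs1 : s ≤ 1) : (s - s⁻¹) / 2 ≤ log s := by
  rw [← sinh_log hs0]
  exact sinh_le_self_iff.2 (log_nonpos hs0.le hs1)

theorem sub_one_sub_half_sq_le_log {s : ℝ} (hs : 1 ≤ s) : s - 1 - (s - 1) ^ 2 / 2 ≤ log s := by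
  have hlog := le_log_one_add_of_nonneg (sub_nonneg.2 hs)
  rw [add_sub_cancel] at hlog
  refine le_trans ?_ hlog
  rw [le_div_iff₀ (by linarith)]
  nlinarith [pow_nonneg (sub_nonneg.2 hs) 3]

theorem log_ge_quadratic {u v d : ℝ} (hd : 0 < d) (hu : d ≤ u) (hv : d ≤ v) :
    log v + (u - v) / v - (u - v) ^ 2 / (2 * d ^ 2) ≤ log u := by
  have hu0 := hd.trans_le hu
  have hv0 := hd.trans_le hv
  have hlog : log u = log v + log (u / v) := by rw [log_div hu0.ne' hv0.ne']; ring
  have hratio : (u - v) / v = u / v - 1 := (div_sub_one hv0.ne').symm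
  rw [hlog]
  rcases le_total v u with hvu | huv
  · have htaylor := sub_one_sub_half_sq_le_log ((one_le_div hv0).2 hvu)
    have herror : (u / v - 1) ^ 2 / 2 ≤ (u - v) ^ 2 / (2 * d ^ 2) := by
      rw [← hratio, div_pow, div_div, mul_comm]
      gcongr
    linarith
  · have hsinh := half_sub_inv_le_log (div_pos hu0 hv0) ((div_le_one hv0).2 huv)
    have herror : (u / v - 1) - (u / v - (u / v)⁻¹) / 2 ≤ (u - v) ^ 2 / (2 * d ^ 2) := by
      have hsq : (u / v - 1) - (u / v - (u / v)⁻¹) / 2 = (u - v) ^ 2 / (2 * (u * v)) := by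
        field_simp; ring
      rw [hsq, sq d]
      gcongr
    linarith

theorem mul_add_mul_sq_le_log_one_add_mul {y u : ℝ} (hy : -1 ≤ y) (hu0 : 0 ≤ u) (hu1 : u < 1) :
    u * y + (log (1 - u) + u) * y ^ 2 ≤ log (1 + u * y) := by
  have hpos : ∀ z ∈ Icc 0 u, 0 < 1 - z ∧ 0 < 1 + z * y := fun z hz =>
    ⟨by linarith [hz.2], by nlinarith [hz.1, hz.2]⟩
  refine le_of_hasDerivAt_le (f := fun z => z * y + (log (1 - z) + z) * y ^ 2)
    (f' := fun z => y + (-1 / (1 - z) + 1) * y ^ 2) (g := fun z => log (1 + z * y))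
    (g' := fun z => y / (1 + z * y)) hu0 (fun z hz => ?_) (fun z hz => ?_) (by simp)
    fun z hz => ?_
  · have hlog := ((hasDerivAt_id z).const_sub 1).log (hpos z hz).1.ne'
    exact (((hasDerivAt_id z).mul_const y).add
      ((hlog.add (hasDerivAt_id z)).mul_const (y ^ 2))).congr_deriv (by simp)
  · simpa using (((hasDerivAt_id z).mul_const y).const_add 1).log (hpos z hz).2.ne'
  · obtain ⟨h1, h2⟩ := hpos z (Ico_subset_Icc_self hz)
    have hdiff : y / (1 + z * y) - (y + (-1 / (1 - z) + 1) * y ^ 2)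
        = y ^ 2 * z * (z * (1 + y)) / ((1 - z) * (1 + z * y)) := by
      have := h1.ne'
      have : 1 + y * z ≠ 0 := by rw [mul_comm]; exact h2.ne'
      field_simp
      ring
    rw [← sub_nonneg, hdiff]
    have hz0 := hz.1
    have hy0 : 0 ≤ 1 + y := by linarith
    positivity

theorem log_one_add_le_pade {z : ℝ} (hz : 0 ≤ z) :
    log (1 + z) ≤ z * (6 + z) / (6 + 4 * z) := by
  refine le_of_hasDerivAt_le (f := fun z => log (1 + z)) (f' := fun z => 1 / (1 + z))
    (g := fun z => z * (6 + z) / (6 + 4 * z))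
    (g' := fun z => (((6 + z) + z) * (6 + 4 * z) - z * (6 + z) * 4) / (6 + 4 * z) ^ 2)
    hz (fun y hy => ?_) (fun y hy => ?_) (by simp) fun y hy => ?_
  · simpa using ((hasDerivAt_id y).const_add 1).log (by simp only [id]; linarith [hy.1])
  · exact (((hasDerivAt_id y).mul ((hasDerivAt_id y).const_add 6)).div
      (((hasDerivAt_id y).const_mul 4).const_add 6)
      (by simp only [id]; linarith [hy.1])).congr_deriv (by simp)
  · have hy0 := hy.1
    have hdiff : (((6 + y) + y) * (6 + 4 * y) - y * (6 + y) * 4) / (6 + 4 * y) ^ 2 - 1 / (1 + y)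
        = 4 * y ^ 3 / ((1 + y) * (6 + 4 * y) ^ 2) := by
      field_simp; ring
    rw [← sub_nonneg, hdiff]
    positivity

theorem sq_div_le_log_one_add_mul_sub {y b : ℝ} (hy : |y| ≤ 1) (hb0 : 0 ≤ b) (hb1 : b < 1) :
    b ^ 2 * y ^ 2 / (2 * (1 + b) ^ 2) ≤ log (1 + b * y) - b * y / (1 + b * y) := by
  obtain ⟨hy1, hy2⟩ := abs_le.1 hy
  have hpos : ∀ z ∈ Icc 0 b, 0 < 1 + z * y := fun z hz => by nlinarith [hz.1, hz.2]
  refine le_of_hasDerivAt_le (f := fun z => z ^ 2 * y ^ 2 / (2 * (1 + b) ^ 2))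
    (f' := fun z => 2 * z * y ^ 2 / (2 * (1 + b) ^ 2))
    (g := fun z => log (1 + z * y) - z * y / (1 + z * y))
    (g' := fun z => y / (1 + z * y) - (y * (1 + z * y) - z * y * y) / (1 + z * y) ^ 2)
    hb0 (fun z _ => ?_) (fun z hz => ?_) (by simp) fun z hz => ?_
  · simpa using (((hasDerivAt_id z).pow 2).mul_const (y ^ 2)).div_const (2 * (1 + b) ^ 2)
  · have hlin := (hasDerivAt_id z).mul_const y
    exact (((hlin.const_add 1).log (hpos z hz).ne').sub
      (hlin.div (hlin.const_add 1) (hpos z hz).ne')).congr_deriv (by simp)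
  · have hz0 := hz.1
    have hz1 := hpos z (Ico_subset_Icc_self hz)
    have hzb : 1 + z * y ≤ 1 + b := by nlinarith [hz.2]
    calc 2 * z * y ^ 2 / (2 * (1 + b) ^ 2) = z * y ^ 2 / (1 + b) ^ 2 := by field_simp
      _ ≤ z * y ^ 2 / (1 + z * y) ^ 2 := by gcongr
      _ = _ := by field_simp; ring

end Elementary

/-! ### The prior density -/

section Prior

theorem c_pos : 0 < c := by unfold c; positivity

theorem le_log_c : 2.887 ≤ log c := by
  have hlog : (1.887 : ℝ) ≤ log 6.6 := by
    rw [le_log_iff_exp_le (by norm_num)]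
    refine (exp_le_taylor_pow (k := 10) (n := 5) (by norm_num) (by norm_num) (by norm_num)
      (by norm_num)).trans ?_
    norm_num [Finset.sum_range_succ, Nat.factorial]
  rw [c, log_mul (by norm_num) (exp_ne_zero _), log_exp]
  linarith

theorem le_log_of_le {u : ℝ} (hu : 2.887 ≤ u) : 1.06 ≤ log u := by
  rw [le_log_iff_exp_le (by linarith)]
  refine (exp_le_taylor_pow (k := 10) (n := 5) (by norm_num) (by norm_num) (by norm_num)
    (by norm_num)).trans (le_trans ?_ hu)
  norm_num [Finset.sum_range_succ, Nat.factorial]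

theorem le_log_log_c : 1.06 ≤ log (log c) := le_log_of_le le_log_c

theorem log_log_c_pos : 0 < log (log c) := by linarith [le_log_log_c]

variable {x : ℝ}

theorem antitoneOn_log_c_div : AntitoneOn (fun x => log (c / x)) (Ioi 0) := fun _ hx _ hy hxy =>
  log_le_log (div_pos c_pos hy) (div_le_div_of_nonneg_left c_pos.le hx hxy)

theorem le_log_c_div (hx : x ∈ Ioc 0 1) : 2.887 ≤ log (c / x) :=
  le_log_c.trans (by simpa using antitoneOn_log_c_div hx.1 (mem_Ioi.2 one_pos) hx.2)

theorem le_log_log_c_div (hx : x ∈ Ioc 0 1) : 1.06 ≤ log (log (c / x)) :=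
  le_log_of_le (le_log_c_div hx)

theorem log_c_div_pos (hx : x ∈ Ioc 0 1) : 0 < log (c / x) := by linarith [le_log_c_div hx]

theorem log_log_c_div_pos (hx : x ∈ Ioc 0 1) : 0 < log (log (c / x)) := by
  linarith [le_log_log_c_div hx]

theorem h_pos (hx : x ∈ Ioc 0 1) : 0 < h x := by
  have := log_log_c_pos
  have := log_c_div_pos hx
  have := log_log_c_div_pos hx
  unfold h
  positivity

theorem antitoneOn_h : AntitoneOn h (Ioc 0 1) := fun x hx y hy hxy => by
  have hlog : log (c / y) ≤ log (c / x) := antitoneOn_log_c_div hx.1 hy.1 hxy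
  have := log_log_c_pos
  have := log_c_div_pos hx
  have := log_c_div_pos hy
  have := log_log_c_div_pos hy
  unfold h
  gcongr

theorem four_le_h (hx : x ∈ Ioc 0 1) : 4 ≤ h x :=
  calc (4 : ℝ) ≤ 2 * log c * log (log c) := by nlinarith [le_log_c, le_log_log_c]
    _ = h 1 := by
        have := log_log_c_pos
        rw [h, div_one]
        field_simp
    _ ≤ h x := antitoneOn_h hx ⟨one_pos, le_rfl⟩ hx.2

theorem hasDerivAt_log_c_div (hx : 0 < x) : HasDerivAt (fun x => log (c / x)) (-(1 / x)) x := by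
  have hsub : HasDerivAt (fun x => log c - log x) (-(1 / x)) x := by
    simpa using (hasDerivAt_log hx.ne').const_sub (log c)
  refine hsub.congr_of_eventuallyEq ?_
  filter_upwards [lt_mem_nhds hx] with y hy
  rw [log_div c_pos.ne' hy.ne']

theorem hasDerivAt_log_log_c_div (hx : x ∈ Ioc 0 1) :
    HasDerivAt (fun x => log (log (c / x))) (-(1 / x) / log (c / x)) x :=
  (hasDerivAt_log_c_div hx.1).log (log_c_div_pos hx).ne'

theorem hasDerivAt_mul_h (hx : x ∈ Ioc 0 1) :
    HasDerivAt (fun x => x * h x)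
      (2 / log (log c) * (log (log (c / x)) * ((log (c / x) - 1) * log (log (c / x)) - 2))) x := by
  have hprod := (hasDerivAt_id x).mul (((hasDerivAt_log_c_div hx.1).const_mul
    (2 / log (log c))).mul ((hasDerivAt_log_log_c_div hx).pow 2))
  refine hprod.congr_deriv ?_
  have := (log_c_div_pos hx).ne'
  have := log_log_c_pos.ne'
  have := hx.1.ne'
  simp only [id, Pi.mul_apply, Pi.pow_apply]
  field_simp
  ring

-- `c = 6.6 e` is just large enough that `(log (c / x) - 1) * log (log (c / x)) ≥ 2` up to `x = 1`.
theorem monotoneOn_mul_h : MonotoneOn (fun x => x * h x) (Ioc 0 1) := by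
  refine monotoneOn_of_hasDerivWithinAt_nonneg (convex_Ioc 0 1)
    (fun x hx => (hasDerivAt_mul_h hx).continuousAt.continuousWithinAt)
    (fun x hx => (hasDerivAt_mul_h (interior_subset hx)).hasDerivWithinAt) fun x hx => ?_
  have hx := interior_subset hx
  have hfactor : 0 ≤ (log (c / x) - 1) * log (log (c / x)) - 2 := by
    nlinarith [le_log_c_div hx, le_log_log_c_div hx]
  have := log_log_c_pos
  have := log_log_c_div_pos hx
  positivity

theorem F_neg (β : ℝ) : F (-β) = F β := by simp only [F, abs_neg]

theorem F_abs (β : ℝ) : F |β| = F β := by simp only [F, abs_abs]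

theorem F_pos {β : ℝ} (hβ0 : β ≠ 0) (hβ1 : |β| ≤ 1) : 0 < F β := by
  have habs := abs_pos.2 hβ0
  have := h_pos ⟨habs, hβ1⟩
  unfold F
  positivity

theorem F_nonneg {β : ℝ} (hβ : |β| ≤ 1) : 0 ≤ F β := by
  rcases eq_or_ne β 0 with rfl | hβ0
  · simp [F]
  · exact (F_pos hβ0 hβ).le

theorem antitoneOn_F : AntitoneOn F (Ioc 0 1) := fun x hx y hy hxy => by
  rw [F, F, abs_of_pos hx.1, abs_of_pos hy.1]
  exact one_div_le_one_div_of_le (mul_pos hx.1 (h_pos hx)) (monotoneOn_mul_h hx hy hxy)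

theorem measurable_F : Measurable F := by
  unfold F h
  fun_prop

/-- The antiderivative `∫ β in 0..x, F β` of the prior density on `[0, 1]`. -/
noncomputable def cdf (x : ℝ) : ℝ := log (log c) / 2 * (log (log (c / x)))⁻¹

theorem hasDerivAt_cdf (hx : x ∈ Ioc 0 1) : HasDerivAt cdf (F x) x := by
  refine (((hasDerivAt_log_log_c_div hx).inv (log_log_c_div_pos hx).ne').const_mul
    (log (log c) / 2)).congr_deriv ?_
  have := (log_c_div_pos hx).ne'
  have := (log_log_c_div_pos hx).ne'
  have := log_log_c_pos.ne'
  have := hx.1.ne'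
  rw [F, h, abs_of_pos hx.1]
  field_simp

theorem continuousOn_cdf : ContinuousOn cdf (Icc 0 1) := by
  intro x hx
  rcases hx.1.eq_or_lt with rfl | hx0
  · have hdiv : Tendsto (fun x => c / x) (nhdsWithin 0 (Icc 0 1 \ {0})) atTop := by
      simp only [div_eq_mul_inv]
      refine Tendsto.const_mul_atTop c_pos (tendsto_inv_nhdsGT_zero.mono_left ?_)
      exact nhdsWithin_mono _ fun y hy => lt_of_le_of_ne hy.1.1 (Ne.symm hy.2)
    have hlim := (tendsto_log_atTop.comp
      (tendsto_log_atTop.comp hdiv)).inv_tendsto_atTop.const_mul (log (log c) / 2)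
    have hzero : cdf 0 = log (log c) / 2 * 0 := by simp [cdf]
    rw [← continuousWithinAt_sdiff_self, ContinuousWithinAt, hzero]
    exact hlim
  · exact (hasDerivAt_cdf ⟨hx0, hx.2⟩).continuousAt.continuousWithinAt

theorem intervalIntegrable_F_zero_one : IntervalIntegrable F volume 0 1 := by
  refine intervalIntegral.intervalIntegrable_deriv_of_nonneg (g := cdf)
    (by simpa only [uIcc_of_le zero_le_one] using continuousOn_cdf) (fun x hx => ?_)
    fun x hx => ?_
  all_goals rw [min_eq_left zero_le_one, max_eq_right zero_le_one] at hx
  · exact hasDerivAt_cdf (Ioo_subset_Ioc_self hx)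
  · exact F_nonneg (by rw [abs_of_pos hx.1]; exact hx.2.le)

theorem intervalIntegrable_F_neg_one_zero : IntervalIntegrable F volume (-1) 0 := by
  simpa [F_neg] using (intervalIntegrable_F_zero_one.comp_sub_left 0).symm

theorem intervalIntegrable_F : IntervalIntegrable F volume (-1) 1 :=
  intervalIntegrable_F_neg_one_zero.trans intervalIntegrable_F_zero_one

theorem integral_F_zero_one : ∫ β in (0 : ℝ)..1, F β = 1 / 2 := by
  rw [intervalIntegral.integral_eq_sub_of_hasDerivAt_of_le zero_le_one continuousOn_cdf
    (fun x hx => hasDerivAt_cdf (Ioo_subset_Ioc_self hx)) intervalIntegrable_F_zero_one]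
  have := log_log_c_pos.ne'
  simp only [cdf, div_one, div_zero, log_zero, inv_zero, mul_zero, sub_zero]
  field_simp

theorem integral_F : ∫ β in (-1 : ℝ)..1, F β = 1 := by
  have hneg : ∫ β in (-1 : ℝ)..0, F β = ∫ β in (0 : ℝ)..1, F β := by
    simpa [F_neg] using (intervalIntegral.integral_comp_neg (a := 0) (b := 1) F).symm
  rw [← intervalIntegral.integral_add_adjacent_intervals intervalIntegrable_F_neg_one_zero
    intervalIntegrable_F_zero_one, hneg, integral_F_zero_one]
  norm_num

end Prior

/-! ### Constant betting fractions on a finite family of coins -/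

section Coins

variable {ι : Type*} {s : Finset ι} {a : ι → ℝ} {b : ℝ}

/-- The wealth of the constant betting fraction `u` on the coins `a i`, `i ∈ s`. -/
noncomputable def coinWealth (s : Finset ι) (a : ι → ℝ) (u : ℝ) : ℝ := ∏ i ∈ s, (1 + u * a i)

/-- The logarithmic derivative of `coinWealth s a` in the betting fraction. -/
noncomputable def score (s : Finset ι) (a : ι → ℝ) (u : ℝ) : ℝ := ∑ i ∈ s, a i / (1 + u * a i)

theorem one_add_mul_nonneg {u y : ℝ} (hu : |u| ≤ 1) (hy : |y| ≤ 1) : 0 ≤ 1 + u * y := by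
  have huy : |u * y| ≤ 1 := by
    rw [abs_mul]
    exact mul_le_one₀ hu (abs_nonneg _) hy
  linarith [(abs_le.1 huy).1]

theorem one_sub_le_one_add_mul {y : ℝ} (hb : 0 ≤ b) (hy : -1 ≤ y) : 1 - b ≤ 1 + b * y := by
  nlinarith

theorem coinWealth_zero : coinWealth s a 0 = 1 := by simp [coinWealth]

theorem coinWealth_mul_coins (r u : ℝ) :
    coinWealth s (fun i => r * a i) u = coinWealth s a (u * r) := by
  simp only [coinWealth, mul_assoc]

theorem coinWealth_nonneg (ha : ∀ i ∈ s, |a i| ≤ 1) (hb : |b| ≤ 1) : 0 ≤ coinWealth s a b :=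
  Finset.prod_nonneg fun i hi => one_add_mul_nonneg hb (ha i hi)

@[fun_prop]
theorem continuous_coinWealth : Continuous (coinWealth s a) := by
  unfold coinWealth
  fun_prop

theorem one_le_coinWealth_of_isMaxOn (hmax : IsMaxOn (coinWealth s a) (Icc (-1) 1) b) :
    1 ≤ coinWealth s a b :=
  coinWealth_zero.symm.le.trans (hmax (by norm_num : (0 : ℝ) ∈ Icc (-1) 1))

theorem log_coinWealth (hb : ∀ i ∈ s, 1 + b * a i ≠ 0) :
    log (coinWealth s a b) = ∑ i ∈ s, log (1 + b * a i) :=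
  log_prod hb

theorem coinWealth_rpow_le (ha : ∀ i ∈ s, |a i| ≤ 1) (hb : |b| ≤ 1) {r : ℝ} (hr0 : 0 ≤ r)
    (hr1 : r ≤ 1) : coinWealth s a b ^ r ≤ coinWealth s a (r * b) := by
  have hnonneg : ∀ i ∈ s, 0 ≤ 1 + b * a i := fun i hi => one_add_mul_nonneg hb (ha i hi)
  rw [coinWealth, ← finsetProd_rpow _ _ hnonneg]
  refine Finset.prod_le_prod (fun i hi => rpow_nonneg (hnonneg i hi) _) fun i hi => ?_
  rw [mul_assoc r]
  exact rpow_one_add_le_one_add_mul_self (by linarith [hnonneg i hi]) hr0 hr1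

theorem continuous_rpow_div {w : ℝ} (hw : 0 < w) : Continuous fun u => w ^ (u / b) :=
  continuous_const.rpow (by fun_prop) fun _ => Or.inl hw.ne'

theorem integral_rpow_div {w : ℝ} (hw : 0 < w) (hb : b ≠ 0) :
    ∫ u in (0 : ℝ)..b, w ^ (u / b) = w * (logRatio w * b) := by
  rcases eq_or_ne w 1 with rfl | hw1
  · simp [logRatio]
  have hlog : log w ≠ 0 := log_ne_zero_of_pos_of_ne_one hw hw1
  have hderiv : ∀ u ∈ uIcc 0 b,
      HasDerivAt (fun u => w ^ (u / b) * (b / log w)) (w ^ (u / b)) u := fun u _ => by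
    refine ((((hasDerivAt_id u).div_const b).const_rpow hw).mul_const (b / log w)).congr_deriv ?_
    simp only [id]
    field_simp
  rw [intervalIntegral.integral_eq_sub_of_hasDerivAt hderiv
    ((continuous_rpow_div hw).intervalIntegrable _ _)]
  simp only [div_self hb, zero_div, rpow_one, rpow_zero, logRatio, hw1, if_false]
  field_simp

theorem coinWealth_mul_logRatio_le_integral (ha : ∀ i ∈ s, |a i| ≤ 1) (hb0 : 0 < b) (hb1 : b ≤ 1)
    (hw : 0 < coinWealth s a b) :
    coinWealth s a b * (logRatio (coinWealth s a b) * b) ≤ ∫ u in (0 : ℝ)..b, coinWealth s a u := by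
  rw [← integral_rpow_div hw hb0.ne']
  refine intervalIntegral.integral_mono_on hb0.le
    ((continuous_rpow_div hw).intervalIntegrable _ _)
    (continuous_coinWealth.intervalIntegrable _ _) fun u hu => ?_
  simpa only [div_mul_cancel₀ u hb0.ne'] using
    coinWealth_rpow_le ha (abs_le.2 ⟨by linarith, hb1⟩) (div_nonneg hu.1 hb0.le)
      (div_le_one_of_le₀ hu.2 hb0.le)

theorem coinWealth_mul_exp_le {u d : ℝ} (hd : 0 < d) (hu : ∀ i ∈ s, d ≤ 1 + u * a i)
    (hb : ∀ i ∈ s, d ≤ 1 + b * a i) (hscore : score s a b = 0) :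
    coinWealth s a b * exp (-((b - u) ^ 2 * ∑ i ∈ s, a i ^ 2) / (2 * d ^ 2))
      ≤ coinWealth s a u := by
  have hu0 : ∀ i ∈ s, 0 < 1 + u * a i := fun i hi => hd.trans_le (hu i hi)
  have hb0 : ∀ i ∈ s, 0 < 1 + b * a i := fun i hi => hd.trans_le (hb i hi)
  have hWu : 0 < coinWealth s a u := Finset.prod_pos hu0
  have hWb : 0 < coinWealth s a b := Finset.prod_pos hb0
  have hlinear : ∑ i ∈ s, ((1 + u * a i) - (1 + b * a i)) / (1 + b * a i) = 0 := by
    calc _ = (u - b) * score s a b := by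
          rw [score, Finset.mul_sum]
          exact Finset.sum_congr rfl fun i _ => by ring
      _ = 0 := by rw [hscore, mul_zero]
  have hquadratic : ∑ i ∈ s, ((1 + u * a i) - (1 + b * a i)) ^ 2 / (2 * d ^ 2)
      = ((b - u) ^ 2 * ∑ i ∈ s, a i ^ 2) / (2 * d ^ 2) := by
    rw [Finset.mul_sum, Finset.sum_div]
    exact Finset.sum_congr rfl fun i _ => by ring
  rw [← log_le_log_iff (mul_pos hWb (exp_pos _)) hWu, log_mul hWb.ne' (exp_ne_zero _), log_exp,
    log_coinWealth fun i hi => (hb0 i hi).ne', log_coinWealth fun i hi => (hu0 i hi).ne']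
  calc _ = ∑ i ∈ s, (log (1 + b * a i) + ((1 + u * a i) - (1 + b * a i)) / (1 + b * a i)
        - ((1 + u * a i) - (1 + b * a i)) ^ 2 / (2 * d ^ 2)) := by
        rw [Finset.sum_sub_distrib, Finset.sum_add_distrib, hlinear, hquadratic]
        ring
    _ ≤ _ := Finset.sum_le_sum fun i hi => log_ge_quadratic hd (hu i hi) (hb i hi)

theorem one_add_mul_ne_zero_of_isMaxOn (hmax : IsMaxOn (coinWealth s a) (Icc (-1) 1) b) {i : ι}
    (hi : i ∈ s) : 1 + b * a i ≠ 0 := fun hzero => by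
  have hW := one_le_coinWealth_of_isMaxOn hmax
  rw [coinWealth, Finset.prod_eq_zero hi hzero] at hW
  linarith

theorem hasDerivAt_coinWealth (hb : ∀ i ∈ s, 1 + b * a i ≠ 0) :
    HasDerivAt (coinWealth s a) (score s a b * coinWealth s a b) b := by
  have hW : coinWealth s a b ≠ 0 := Finset.prod_ne_zero_iff.2 hb
  have hlin : ∀ i, HasDerivAt (fun u => 1 + u * a i) (a i) b := fun i => by
    simpa using ((hasDerivAt_id b).mul_const (a i)).const_add 1
  have hdiff : DifferentiableAt ℝ (coinWealth s a) b := by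
    unfold coinWealth
    fun_prop
  have hscore : logDeriv (coinWealth s a) b = score s a b := by
    refine (logDeriv_prod (f := fun i u => 1 + u * a i) hb fun i _ =>
      (hlin i).differentiableAt).trans ?_
    simp only [logDeriv_apply, (hlin _).deriv, score]
  rw [← hscore, logDeriv_apply, div_mul_cancel₀ _ hW]
  exact hdiff.hasDerivAt

theorem score_nonneg_of_isMaxOn (hb0 : 0 < b) (hb1 : b ≤ 1)
    (hmax : IsMaxOn (coinWealth s a) (Icc (-1) 1) b) : 0 ≤ score s a b := by
  have hW := one_le_coinWealth_of_isMaxOn hmax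
  have hsegment : segment ℝ b 0 ⊆ Icc (-1) 1 :=
    (convex_Icc (-1 : ℝ) 1).segment_subset ⟨by linarith, hb1⟩ (by norm_num)
  have hslope := hmax.localize.hasFDerivWithinAt_nonpos
    (hasDerivAt_coinWealth fun i hi =>
      one_add_mul_ne_zero_of_isMaxOn hmax hi).hasFDerivAt.hasFDerivWithinAt
    (sub_mem_posTangentConeAt_of_segment_subset hsegment)
  simp only [ContinuousLinearMap.toSpanSingleton_apply, zero_sub, smul_eq_mul] at hslope
  have hprod : 0 ≤ (b * coinWealth s a b) * score s a b := by linarith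
  exact nonneg_of_mul_nonneg_right hprod (by positivity)

theorem score_eq_zero_of_isMaxOn (hb : b ∈ Ioo (-1) 1)
    (hmax : IsMaxOn (coinWealth s a) (Icc (-1) 1) b) : score s a b = 0 := by
  have hW := one_le_coinWealth_of_isMaxOn hmax
  have hderiv := (hmax.isLocalMax (Icc_mem_nhds hb.1 hb.2)).hasDerivAt_eq_zero
    (hasDerivAt_coinWealth fun i hi => one_add_mul_ne_zero_of_isMaxOn hmax hi)
  exact (mul_eq_zero.1 hderiv).resolve_right (by linarith)

theorem sum_eq_score_add (hb : ∀ i ∈ s, 1 + b * a i ≠ 0) :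
    ∑ i ∈ s, a i = score s a b + b * ∑ i ∈ s, a i ^ 2 / (1 + b * a i) := by
  rw [score, Finset.mul_sum, ← Finset.sum_add_distrib]
  refine Finset.sum_congr rfl fun i hi => ?_
  rw [mul_div_assoc', ← add_div, eq_div_iff (hb i hi)]
  ring

theorem sum_mul_one_sub_le (ha : ∀ i ∈ s, -1 ≤ a i) (hb0 : 0 ≤ b) (hb1 : b < 1)
    (hscore : score s a b = 0) : (∑ i ∈ s, a i) * (1 - b) ≤ b * ∑ i ∈ s, a i ^ 2 := by
  have hle : ∀ i ∈ s, 1 - b ≤ 1 + b * a i := fun i hi => one_sub_le_one_add_mul hb0 (ha i hi)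
  have hpos : ∀ i ∈ s, 0 < 1 + b * a i := fun i hi => (sub_pos.2 hb1).trans_le (hle i hi)
  rw [sum_eq_score_add fun i hi => (hpos i hi).ne', hscore, zero_add, mul_assoc, Finset.sum_mul]
  gcongr with i hi
  rw [div_mul_eq_mul_div, div_le_iff₀ (hpos i hi)]
  gcongr
  exact hle i hi

theorem mul_sum_sq_le (ha : ∀ i ∈ s, a i ≤ 1) (hb0 : 0 ≤ b) (hb1 : b ≤ 1)
    (hpos : ∀ i ∈ s, 0 < 1 + b * a i) (hscore : 0 ≤ score s a b) :
    b * ∑ i ∈ s, a i ^ 2 ≤ 2 * ∑ i ∈ s, a i := by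
  have hsq : ∑ i ∈ s, a i ^ 2 ≤ 2 * ∑ i ∈ s, a i ^ 2 / (1 + b * a i) := by
    rw [Finset.mul_sum]
    refine Finset.sum_le_sum fun i hi => ?_
    rw [mul_div_assoc', le_div_iff₀ (hpos i hi), mul_comm 2]
    gcongr
    nlinarith [ha i hi]
  rw [sum_eq_score_add fun i hi => (hpos i hi).ne']
  nlinarith

theorem sq_mul_sum_sq_le_log_coinWealth (ha : ∀ i ∈ s, |a i| ≤ 1) (hb0 : 0 ≤ b) (hb1 : b < 1)
    (hscore : score s a b = 0) :
    b ^ 2 * (∑ i ∈ s, a i ^ 2) / (2 * (1 + b) ^ 2) ≤ log (coinWealth s a b) := by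
  have hpos : ∀ i ∈ s, 0 < 1 + b * a i := fun i hi =>
    (sub_pos.2 hb1).trans_le (one_sub_le_one_add_mul hb0 (abs_le.1 (ha i hi)).1)
  have hlinear : ∑ i ∈ s, b * a i / (1 + b * a i) = 0 := by
    simp only [mul_div_assoc, ← Finset.mul_sum]
    rw [← score, hscore, mul_zero]
  calc b ^ 2 * (∑ i ∈ s, a i ^ 2) / (2 * (1 + b) ^ 2)
      = ∑ i ∈ s, b ^ 2 * a i ^ 2 / (2 * (1 + b) ^ 2) := by rw [Finset.mul_sum, Finset.sum_div]
    _ ≤ ∑ i ∈ s, (log (1 + b * a i) - b * a i / (1 + b * a i)) :=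
        Finset.sum_le_sum fun i hi => sq_div_le_log_one_add_mul_sub (ha i hi) hb0 hb1
    _ = log (coinWealth s a b) := by
        rw [Finset.sum_sub_distrib, hlinear, sub_zero, log_coinWealth fun i hi => (hpos i hi).ne']

-- The betting fraction is `u = S / (S + V)`.
theorem exists_log_coinWealth_ge (ha : ∀ i ∈ s, -1 ≤ a i) (hsum : 0 < ∑ i ∈ s, a i) :
    ∃ u ∈ Icc (0 : ℝ) 1, 0 < coinWealth s a u ∧
      (∑ i ∈ s, a i) ^ 2 / (2 * (∑ i ∈ s, a i ^ 2 + 2 / 3 * ∑ i ∈ s, a i))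
        ≤ log (coinWealth s a u) := by
  have hV0 : 0 < ∑ i ∈ s, a i ^ 2 := by
    obtain ⟨i, hi, hai⟩ := Finset.exists_ne_zero_of_sum_ne_zero hsum.ne'
    exact Finset.sum_pos' (fun i _ => sq_nonneg _) ⟨i, hi, by positivity⟩
  set S := ∑ i ∈ s, a i
  set V := ∑ i ∈ s, a i ^ 2
  have hu0 : 0 ≤ S / (S + V) := by positivity
  have hu1 : S / (S + V) < 1 := by
    rw [div_lt_one (by positivity)]
    linarith
  have hpos : ∀ i ∈ s, 0 < 1 + S / (S + V) * a i := fun i hi =>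
    (sub_pos.2 hu1).trans_le (one_sub_le_one_add_mul hu0 (ha i hi))
  refine ⟨S / (S + V), ⟨hu0, hu1.le⟩, Finset.prod_pos hpos, ?_⟩
  have hpade := log_one_add_le_pade (z := S / V) (by positivity)
  have hlog : log (1 - S / (S + V)) = -log (1 + S / V) := by
    rw [← log_inv]
    congr 1
    field_simp
    ring
  calc S ^ 2 / (2 * (V + 2 / 3 * S))
      = V * (S / V - (S / V) * (6 + S / V) / (6 + 4 * (S / V))) := by field_simp; ring
    _ ≤ V * (S / V - log (1 + S / V)) := by gcongr
    _ = S / (S + V) * S + (log (1 - S / (S + V)) + S / (S + V)) * V := by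
        rw [hlog]
        field_simp
        ring
    _ = ∑ i ∈ s, (S / (S + V) * a i + (log (1 - S / (S + V)) + S / (S + V)) * a i ^ 2) := by
        rw [Finset.sum_add_distrib, ← Finset.mul_sum, ← Finset.mul_sum]
    _ ≤ ∑ i ∈ s, log (1 + S / (S + V) * a i) :=
        Finset.sum_le_sum fun i hi => mul_add_mul_sq_le_log_one_add_mul (ha i hi) hu0 hu1
    _ = log (coinWealth s a (S / (S + V))) := (log_coinWealth fun i hi => (hpos i hi).ne').symm

end Coins

theorem integral_mul_le_integral_mul_of_antitoneOn {f g : ℝ → ℝ} (hg : Continuous g)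
    (hg0 : ∀ u, |u| ≤ 1 → 0 ≤ g u) (hf : IntervalIntegrable f volume (-1) 1)
    (hf0 : ∀ u, |u| ≤ 1 → 0 ≤ f u) (hanti : AntitoneOn f (Ioc 0 1)) {l b : ℝ} (hl : 0 ≤ l)
    (hlb : l ≤ b) (hb : b ≤ 1) : (∫ u in l..b, g u) * f b ≤ ∫ u in (-1 : ℝ)..1, g u * f u := by
  have hfg : IntervalIntegrable (fun u => g u * f u) volume (-1) 1 :=
    hf.continuousOn_mul hg.continuousOn
  calc (∫ u in l..b, g u) * f b = ∫ u in l..b, g u * f b :=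
        (intervalIntegral.integral_mul_const _ _).symm
    _ ≤ ∫ u in l..b, g u * f u := by
        refine intervalIntegral.integral_mono_on_of_le_Ioo hlb
          ((hg.mul continuous_const).intervalIntegrable _ _) (hfg.mono_set ?_) fun u hu => ?_
        · rw [uIcc_of_le hlb, uIcc_of_le (by norm_num)]
          exact Icc_subset_Icc (by linarith) hb
        · have hu0 : 0 < u := hl.trans_lt hu.1
          have hu1 : u ≤ 1 := hu.2.le.trans hb
          exact mul_le_mul_of_nonneg_left
            (hanti ⟨hu0, hu1⟩ ⟨hu0.trans hu.2, hb⟩ hu.2.le) (hg0 u (abs_le.2 ⟨by linarith, hu1⟩))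
    _ ≤ ∫ u in (-1 : ℝ)..1, g u * f u := by
        refine intervalIntegral.integral_mono_interval (by linarith) hlb hb ?_ hfg
        refine (ae_restrict_iff' measurableSet_Ioc).2 (ae_of_all _ fun u hu => ?_)
        have hu1 : |u| ≤ 1 := abs_le.2 ⟨hu.1.le, hu.2⟩
        exact mul_nonneg (hg0 u hu1) (hf0 u hu1)

/-! ### Regret of the mixture strategy -/

/-- The coins `x i - m`, reflected so that their best betting fraction is `|betaStar x t m|`. -/
noncomputable def coin (x : ℕ → ℝ) (t : ℕ) (m : ℝ) (i : ℕ) : ℝ :=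
  sign (betaStar x t m) * (x i - m)

/-- The reciprocal `1 / R_t(m)` as a real number, equal to `0` when `R_t(m) = ∞`. -/
noncomputable def invR (x : ℕ → ℝ) (t : ℕ) (m : ℝ) : ℝ :=
  max (logRatio (wealthStar x t m) * |betaStar x t m|)
    (exp (-(Delta x t m ^ 2 * V x t m) / (2 * d x t m ^ 2)) * Delta x t m) * F (betaStar x t m)

section Regret

variable {x : ℕ → ℝ} {t : ℕ} {m δ : ℝ}

theorem sign_mul_sign_self {β : ℝ} (hβ : β ≠ 0) : sign β * sign β = 1 := by
  rcases sign_apply_eq_of_ne_zero β hβ with hs | hs <;> simp [hs]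

theorem abs_sign_le_one (β : ℝ) : |sign β| ≤ 1 := by
  rcases sign_apply_eq β with hs | hs | hs <;> simp [hs]

theorem abs_mul_sign_self (β : ℝ) : |β| * sign β = β := by
  rcases lt_trichotomy β 0 with hβ | rfl | hβ
  · rw [sign_of_neg hβ, abs_of_neg hβ, mul_neg_one, neg_neg]
  · rw [sign_zero, mul_zero]
  · rw [sign_of_pos hβ, abs_of_pos hβ, mul_one]

theorem abs_sub_le_one (hx : ∀ i, x i ∈ Icc (0 : ℝ) 1) (hm : m ∈ Icc (0 : ℝ) 1) (i : ℕ) :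
    |x i - m| ≤ 1 :=
  abs_le.2 ⟨by linarith [(hx i).1, hm.2], by linarith [(hx i).2, hm.1]⟩

theorem abs_coin_le_one (hx : ∀ i, x i ∈ Icc (0 : ℝ) 1) (hm : m ∈ Icc (0 : ℝ) 1) (i : ℕ) :
    |coin x t m i| ≤ 1 := by
  rw [coin, abs_mul]
  exact mul_le_one₀ (abs_sign_le_one _) (abs_nonneg _) (abs_sub_le_one hx hm i)

theorem wealth_nonneg (hx : ∀ i, x i ∈ Icc (0 : ℝ) 1) (hm : m ∈ Icc (0 : ℝ) 1) {β : ℝ}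
    (hβ : |β| ≤ 1) : 0 ≤ wealth x t m β :=
  coinWealth_nonneg (fun i _ => abs_sub_le_one hx hm i) hβ

theorem mixtureWealth_nonneg (hx : ∀ i, x i ∈ Icc (0 : ℝ) 1) (hm : m ∈ Icc (0 : ℝ) 1) :
    0 ≤ mixtureWealth x t m :=
  intervalIntegral.integral_nonneg (by norm_num) fun _ hβ =>
    mul_nonneg (wealth_nonneg hx hm (abs_le.2 hβ)) (F_nonneg (abs_le.2 hβ))

theorem betaStar_mem_Icc : betaStar x t m ∈ Icc (-1 : ℝ) 1 := (exists_best x t m).choose_spec.1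

theorem abs_betaStar_le_one : |betaStar x t m| ≤ 1 := abs_le.2 betaStar_mem_Icc

theorem isMaxOn_betaStar : IsMaxOn (wealth x t m) (Icc (-1) 1) (betaStar x t m) :=
  (exists_best x t m).choose_spec.2

theorem wealth_le_wealthStar {β : ℝ} (hβ : |β| ≤ 1) : wealth x t m β ≤ wealthStar x t m :=
  isMaxOn_betaStar (abs_le.1 hβ)

theorem one_le_wealthStar : 1 ≤ wealthStar x t m :=
  one_le_coinWealth_of_isMaxOn isMaxOn_betaStar

theorem wealthStar_pos : 0 < wealthStar x t m := zero_lt_one.trans_le one_le_wealthStar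

theorem coinWealth_coin (u : ℝ) :
    coinWealth (Finset.range t) (coin x t m) u = wealth x t m (u * sign (betaStar x t m)) :=
  coinWealth_mul_coins _ _

theorem coinWealth_coin_abs_betaStar :
    coinWealth (Finset.range t) (coin x t m) |betaStar x t m| = wealthStar x t m := by
  rw [coinWealth_coin, abs_mul_sign_self, wealthStar]

theorem isMaxOn_abs_betaStar :
    IsMaxOn (coinWealth (Finset.range t) (coin x t m)) (Icc (-1) 1) |betaStar x t m| := by
  intro u hu
  change coinWealth _ _ u ≤ coinWealth _ _ _
  rw [coinWealth_coin_abs_betaStar, coinWealth_coin]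
  refine wealth_le_wealthStar ?_
  rw [abs_mul]
  exact mul_le_one₀ (abs_le.2 hu) (abs_nonneg _) (abs_sign_le_one _)

theorem score_coin_eq_zero (h1 : |betaStar x t m| < 1) :
    score (Finset.range t) (coin x t m) |betaStar x t m| = 0 :=
  score_eq_zero_of_isMaxOn ⟨by linarith [abs_nonneg (betaStar x t m)], h1⟩ isMaxOn_abs_betaStar

theorem mixtureWealth_eq_integral_coinWealth (h0 : betaStar x t m ≠ 0) :
    mixtureWealth x t m
      = ∫ u in (-1 : ℝ)..1, coinWealth (Finset.range t) (coin x t m) u * F u := by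
  simp only [mixtureWealth, coinWealth_coin]
  rcases sign_apply_eq_of_ne_zero _ h0 with hs | hs
  · have hneg := intervalIntegral.integral_comp_neg (a := -1) (b := 1)
      fun u => wealth x t m u * F u
    simp only [F_neg, neg_neg] at hneg
    simp only [hs, mul_neg_one, hneg]
  · simp only [hs, mul_one]

theorem V_eq_sum_coin_sq (h0 : betaStar x t m ≠ 0) :
    V x t m = ∑ i ∈ Finset.range t, coin x t m i ^ 2 := by
  simp only [V, coin, mul_pow, sq (sign _), sign_mul_sign_self h0, one_mul]

theorem V_nonneg : 0 ≤ V x t m := Finset.sum_nonneg fun _ _ => sq_nonneg _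

theorem q_le_coin {i : ℕ} (hi : i ∈ Finset.range t) : q x t m ≤ coin x t m i := by
  rw [coin, mul_comm]
  exact ciInf_le (finite_range _).bddBelow (⟨i, Finset.mem_range.1 hi⟩ : Fin t)

theorem d_le_one_add_mul_coin {i : ℕ} (hi : i ∈ Finset.range t) {u : ℝ} (hu0 : 0 ≤ u)
    (hu : u ≤ |betaStar x t m|) : d x t m ≤ 1 + u * coin x t m i := by
  have hq := q_le_coin (x := x) (m := m) hi
  unfold d
  gcongr
  rcases le_total 0 (coin x t m i) with hc | hc
  · exact (min_le_right _ _).trans (by positivity)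
  · exact (min_le_left _ _).trans (by nlinarith [abs_nonneg (betaStar x t m)])

theorem one_sub_abs_betaStar_le_d (hx : ∀ i, x i ∈ Icc (0 : ℝ) 1) (hm : m ∈ Icc (0 : ℝ) 1) :
    1 - |betaStar x t m| ≤ d x t m := by
  have hq : -1 ≤ q x t m := Real.le_iInf (fun i => by
    rw [mul_comm]
    exact (abs_le.1 (abs_coin_le_one hx hm i)).1) (by norm_num)
  have hb := abs_nonneg (betaStar x t m)
  have hmin : -|betaStar x t m| ≤ min (q x t m * |betaStar x t m|) 0 :=
    le_min (by nlinarith) (by linarith)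
  unfold d
  linarith

theorem integral_coinWealth_mul_F_le (hx : ∀ i, x i ∈ Icc (0 : ℝ) 1) (hm : m ∈ Icc (0 : ℝ) 1)
    (h0 : betaStar x t m ≠ 0) {l : ℝ} (hl : 0 ≤ l) (hlb : l ≤ |betaStar x t m|) :
    (∫ u in l..|betaStar x t m|, coinWealth (Finset.range t) (coin x t m) u) * F (betaStar x t m)
      ≤ mixtureWealth x t m := by
  rw [mixtureWealth_eq_integral_coinWealth h0, ← F_abs]
  exact integral_mul_le_integral_mul_of_antitoneOn continuous_coinWealth
    (fun u hu => coinWealth_nonneg (fun i _ => abs_coin_le_one hx hm i) hu) intervalIntegrable_F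
    (fun u hu => F_nonneg hu) antitoneOn_F hl hlb abs_betaStar_le_one

theorem wealthStar_mul_logRatio_mul_F_le (hx : ∀ i, x i ∈ Icc (0 : ℝ) 1)
    (hm : m ∈ Icc (0 : ℝ) 1) (h0 : betaStar x t m ≠ 0) :
    wealthStar x t m * (logRatio (wealthStar x t m) * |betaStar x t m|) * F (betaStar x t m)
      ≤ mixtureWealth x t m := by
  have hintegral := coinWealth_mul_logRatio_le_integral (s := Finset.range t)
    (fun i _ => abs_coin_le_one (t := t) hx hm i) (abs_pos.2 h0) abs_betaStar_le_one
    (coinWealth_coin_abs_betaStar.symm ▸ wealthStar_pos)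
  rw [coinWealth_coin_abs_betaStar] at hintegral
  exact (mul_le_mul_of_nonneg_right hintegral (F_nonneg abs_betaStar_le_one)).trans
    (integral_coinWealth_mul_F_le hx hm h0 le_rfl (abs_nonneg _))

theorem Delta_eq_zero (h1 : |betaStar x t m| = 1) : Delta x t m = 0 := by
  simp [Delta, deltaTilde, h1]

theorem Delta_mem_Icc (hx : ∀ i, x i ∈ Icc (0 : ℝ) 1) (hm : m ∈ Icc (0 : ℝ) 1) :
    Delta x t m ∈ Icc 0 |betaStar x t m| := by
  have hd : 0 ≤ d x t m :=
    (sub_nonneg.2 abs_betaStar_le_one).trans (one_sub_abs_betaStar_le_d hx hm)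
  have hdelta : 0 ≤ deltaTilde x t m := by
    unfold deltaTilde
    split_ifs <;> positivity
  exact ⟨sub_nonneg.2 (max_le (by linarith) (abs_nonneg _)), sub_le_self _ (le_max_right _ _)⟩

theorem wealthStar_mul_exp_le_coinWealth (hx : ∀ i, x i ∈ Icc (0 : ℝ) 1)
    (hm : m ∈ Icc (0 : ℝ) 1) (h0 : betaStar x t m ≠ 0) (h1 : |betaStar x t m| < 1) {u : ℝ}
    (hu : u ∈ Icc 0 |betaStar x t m|) :
    wealthStar x t m * exp (-((|betaStar x t m| - u) ^ 2 * V x t m) / (2 * d x t m ^ 2))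
      ≤ coinWealth (Finset.range t) (coin x t m) u := by
  have hd : 0 < d x t m := (sub_pos.2 h1).trans_le (one_sub_abs_betaStar_le_d hx hm)
  rw [← coinWealth_coin_abs_betaStar, V_eq_sum_coin_sq h0]
  exact coinWealth_mul_exp_le hd (fun i hi => d_le_one_add_mul_coin hi hu.1 hu.2)
    (fun i hi => d_le_one_add_mul_coin hi (abs_nonneg _) le_rfl) (score_coin_eq_zero h1)

theorem wealthStar_mul_exp_mul_Delta_mul_F_le (hx : ∀ i, x i ∈ Icc (0 : ℝ) 1)
    (hm : m ∈ Icc (0 : ℝ) 1) (h0 : betaStar x t m ≠ 0) :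
    wealthStar x t m * (exp (-(Delta x t m ^ 2 * V x t m) / (2 * d x t m ^ 2)) * Delta x t m)
      * F (betaStar x t m) ≤ mixtureWealth x t m := by
  rcases abs_betaStar_le_one.eq_or_lt with h1 | h1
  · rw [Delta_eq_zero h1, mul_zero, mul_zero, zero_mul]
    exact mixtureWealth_nonneg hx hm
  have hDelta := Delta_mem_Icc (t := t) hx hm
  have hl : 0 ≤ |betaStar x t m| - Delta x t m := sub_nonneg.2 hDelta.2
  have hlb : |betaStar x t m| - Delta x t m ≤ |betaStar x t m| := sub_le_self _ hDelta.1
  refine le_trans ?_ (integral_coinWealth_mul_F_le hx hm h0 hl hlb)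
  gcongr
  · exact F_nonneg abs_betaStar_le_one
  calc _ = ∫ _ in |betaStar x t m| - Delta x t m..|betaStar x t m|,
        wealthStar x t m * exp (-(Delta x t m ^ 2 * V x t m) / (2 * d x t m ^ 2)) := by
        rw [intervalIntegral.integral_const, sub_sub_cancel, smul_eq_mul]
        ring
    _ ≤ _ := by
        refine intervalIntegral.integral_mono_on hlb intervalIntegrable_const
          (continuous_coinWealth.intervalIntegrable _ _) fun u hu => ?_
        refine le_trans ?_ (wealthStar_mul_exp_le_coinWealth hx hm h0 h1 ⟨hl.trans hu.1, hu.2⟩)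
        have hV := V_nonneg (x := x) (t := t) (m := m)
        have hu0 : 0 ≤ |betaStar x t m| - u := sub_nonneg.2 hu.2
        have huDelta : |betaStar x t m| - u ≤ Delta x t m := by linarith [hu.1]
        gcongr
        exact wealthStar_pos.le

theorem logRatio_pos {w : ℝ} (hw : 1 ≤ w) : 0 < logRatio w := by
  rcases hw.eq_or_lt with rfl | hw
  · simp [logRatio]
  · rw [logRatio, if_neg hw.ne']
    exact div_pos (sub_pos.2 ((div_lt_one (by linarith)).2 hw)) (log_pos hw)

theorem invR_pos (h0 : betaStar x t m ≠ 0) : 0 < invR x t m :=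
  mul_pos (lt_max_of_lt_left (mul_pos (logRatio_pos one_le_wealthStar) (abs_pos.2 h0)))
    (F_pos h0 abs_betaStar_le_one)

theorem wealthStar_mul_invR_le (hx : ∀ i, x i ∈ Icc (0 : ℝ) 1) (hm : m ∈ Icc (0 : ℝ) 1)
    (h0 : betaStar x t m ≠ 0) : wealthStar x t m * invR x t m ≤ mixtureWealth x t m := by
  rw [invR, ← mul_assoc, mul_max_of_nonneg _ _ wealthStar_pos.le,
    max_mul_of_nonneg _ _ (F_nonneg abs_betaStar_le_one)]
  exact max_le (wealthStar_mul_logRatio_mul_F_le hx hm h0)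
    (wealthStar_mul_exp_mul_Delta_mul_F_le hx hm h0)

theorem R_eq_top (h0 : betaStar x t m = 0) : R x t m = ⊤ := by simp [R, F, h0]

theorem R_eq_ofReal (h0 : betaStar x t m ≠ 0) : R x t m = ENNReal.ofReal (1 / invR x t m) := by
  rw [ENNReal.ofReal_div_of_pos (invR_pos h0), ENNReal.ofReal_one]
  rfl

theorem regret_le_log_R (hx : ∀ i, x i ∈ Icc (0 : ℝ) 1) (hm : m ∈ Icc (0 : ℝ) 1) :
    (regret x t m : EReal) ≤ ENNReal.log (R x t m) := by
  by_cases h0 : betaStar x t m = 0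
  · rw [R_eq_top h0, ENNReal.log_top]
    exact le_top
  have hR := invR_pos h0
  have hlog := log_le_log (mul_pos wealthStar_pos hR) (wealthStar_mul_invR_le hx hm h0)
  rw [log_mul wealthStar_pos.ne' hR.ne'] at hlog
  rw [R_eq_ofReal h0, ENNReal.log_ofReal, if_neg (not_le.2 (by positivity)),
    EReal.coe_le_coe_iff, one_div, log_inv, regret]
  linarith

/-! ### Accepted means -/

theorem mem_accepted_of_betaStar_eq_zero (h0 : betaStar x t m = 0) : m ∈ accepted δ x t := by
  change (_ : ℝ≥0∞) ≤ _
  rw [R_eq_top h0, ENNReal.top_div_of_ne_top ENNReal.ofReal_ne_top]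
  exact le_top

theorem mem_accepted_iff (hδ : 0 < δ) (h0 : betaStar x t m ≠ 0) :
    m ∈ accepted δ x t ↔ wealthStar x t m * invR x t m ≤ 1 / δ := by
  have hR := invR_pos h0
  change (_ : ℝ≥0∞) ≤ _ ↔ _
  rw [R_eq_ofReal h0, ← ENNReal.ofReal_div_of_pos hδ, ENNReal.ofReal_le_ofReal_iff (by positivity),
    div_right_comm, le_div_iff₀ hR]

theorem mem_accepted_of_mixtureWealth_le (hδ : 0 < δ) (hx : ∀ i, x i ∈ Icc (0 : ℝ) 1)
    (hm : m ∈ Icc (0 : ℝ) 1) (hle : mixtureWealth x t m ≤ 1 / δ) : m ∈ accepted δ x t := by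
  by_cases h0 : betaStar x t m = 0
  · exact mem_accepted_of_betaStar_eq_zero h0
  · exact (mem_accepted_iff hδ h0).2 ((wealthStar_mul_invR_le hx hm h0).trans hle)

theorem continuous_wealth : Continuous (wealth x t m) := continuous_coinWealth

theorem intervalIntegrable_wealth_mul {g : ℝ → ℝ} {a b : ℝ}
    (hg : IntervalIntegrable g volume a b) :
    IntervalIntegrable (fun β => wealth x t m β * g β) volume a b :=
  hg.continuousOn_mul continuous_wealth.continuousOn

theorem mixtureWealth_le_wealthStar : mixtureWealth x t m ≤ wealthStar x t m := by
  calc mixtureWealth x t m ≤ ∫ β in (-1 : ℝ)..1, wealthStar x t m * F β :=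
        intervalIntegral.integral_mono_on (by norm_num)
          (intervalIntegrable_wealth_mul intervalIntegrable_F) (intervalIntegrable_F.const_mul _)
          fun β hβ => mul_le_mul_of_nonneg_right
            (wealth_le_wealthStar (abs_le.2 hβ)) (F_nonneg (abs_le.2 hβ))
    _ = wealthStar x t m := by
        rw [intervalIntegral.integral_const_mul, integral_F, mul_one]

theorem wealth_le_exp (hx : ∀ i, x i ∈ Icc (0 : ℝ) 1) (hm : m ∈ Icc (0 : ℝ) 1) {β : ℝ}
    (hβ : |β| ≤ 1) : wealth x t m β ≤ exp (β * ∑ i ∈ Finset.range t, (x i - m)) := by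
  rw [wealth, Finset.mul_sum, exp_sum]
  refine Finset.prod_le_prod (fun i _ => one_add_mul_nonneg hβ (abs_sub_le_one hx hm i))
    fun i _ => ?_
  rw [add_comm]
  exact add_one_le_exp _

theorem muHat_mem_Icc (hx : ∀ i, x i ∈ Icc (0 : ℝ) 1) (t : ℕ) : muHat x t ∈ Icc (0 : ℝ) 1 := by
  refine ⟨div_nonneg (Finset.sum_nonneg fun i _ => (hx i).1) t.cast_nonneg,
    div_le_one_of_le₀ ?_ t.cast_nonneg⟩
  simpa using Finset.sum_le_card_nsmul (Finset.range t) x 1 fun i _ => (hx i).2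

theorem sum_sub_eq (x : ℕ → ℝ) (t : ℕ) (m : ℝ) :
    ∑ i ∈ Finset.range t, (x i - m) = t * (muHat x t - m) := by
  rcases t.eq_zero_or_pos with rfl | ht
  · simp
  rw [Finset.sum_sub_distrib, Finset.sum_const, Finset.card_range, nsmul_eq_mul, muHat, mul_sub,
    mul_div_cancel₀ _ (Nat.cast_ne_zero.2 ht.ne')]

theorem muHat_mem_accepted (hδ : δ ∈ Ioo (0 : ℝ) 1) (hx : ∀ i, x i ∈ Icc (0 : ℝ) 1) :
    muHat x t ∈ accepted δ x t := by
  have hm := muHat_mem_Icc hx t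
  have hexp : wealthStar x t (muHat x t) ≤ _ := wealth_le_exp hx hm abs_betaStar_le_one
  rw [sum_sub_eq, sub_self, mul_zero, mul_zero, exp_zero] at hexp
  refine mem_accepted_of_mixtureWealth_le hδ.1 hx hm ?_
  exact (mixtureWealth_le_wealthStar.trans hexp).trans ((one_le_div hδ.1).2 hδ.2.le)

end Regret

/-! ### Coverage of the confidence sequence -/

section Coverage

variable {Ω : Type*} [m0 : MeasurableSpace Ω] {P : Measure Ω} {x : ℕ → ℝ} {t : ℕ} {m δ μ : ℝ}

theorem ofReal_mul_measure_exists_lt_le [IsFiniteMeasure P] {𝒢 : Filtration ℕ m0}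
    {f : ℕ → Ω → ℝ} (hf : Martingale f 𝒢 P) (hnonneg : 0 ≤ f) (r : ℝ) :
    ENNReal.ofReal r * P {ω | ∃ t, r < f t ω} ≤ ENNReal.ofReal (∫ ω, f 0 ω ∂P) := by
  have hmono : Monotone fun n : ℕ => {ω | ∃ t ≤ n, r < f t ω} :=
    fun n k hnk ω ⟨t, ht, hlt⟩ => ⟨t, ht.trans hnk, hlt⟩
  have hunion : {ω | ∃ t, r < f t ω} = ⋃ n : ℕ, {ω | ∃ t ≤ n, r < f t ω} := by
    ext ω
    simp only [mem_ofPred_eq, mem_iUnion]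
    exact ⟨fun ⟨t, hlt⟩ => ⟨t, t, le_rfl, hlt⟩, fun ⟨_, t, _, hlt⟩ => ⟨t, hlt⟩⟩
  rw [hunion, hmono.measure_iUnion, ENNReal.mul_iSup]
  refine iSup_le fun n => ?_
  have hexpectation : ∫ ω, f n ω ∂P = ∫ ω, f 0 ω ∂P := by
    simpa only [setIntegral_univ] using (hf.setIntegral_eq n.zero_le MeasurableSet.univ).symm
  have hsup : {ω | ∃ t ≤ n, r < f t ω} ⊆ {ω | (r.toNNReal : ℝ) ≤
      (Finset.range (n + 1)).sup' Finset.nonempty_range_add_one fun k => f k ω} := by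
    rintro ω ⟨t, ht, hlt⟩
    rw [mem_ofPred_eq, coe_toNNReal']
    exact (max_le hlt.le (hnonneg t ω)).trans
      (Finset.le_sup' (fun k => f k ω) (Finset.mem_range_succ_iff.2 ht))
  calc ENNReal.ofReal r * P {ω | ∃ t ≤ n, r < f t ω}
      ≤ ENNReal.ofReal r * P {ω | (r.toNNReal : ℝ) ≤
          (Finset.range (n + 1)).sup' Finset.nonempty_range_add_one fun k => f k ω} := by gcongr
    _ ≤ _ := maximal_ineq hf.submartingale hnonneg n
    _ ≤ ENNReal.ofReal (∫ ω, f 0 ω ∂P) := by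
        rw [← hexpectation]
        exact ENNReal.ofReal_le_ofReal
          (setIntegral_le_integral (hf.integrable n) (ae_of_all _ (hnonneg n)))

theorem condExp_add_mul_sub_const [IsFiniteMeasure P] {𝒜 : MeasurableSpace Ω} (h𝒜 : 𝒜 ≤ m0)
    {M G Y : Ω → ℝ} {C : ℝ} (hM : StronglyMeasurable[𝒜] M) (hMint : Integrable M P)
    (hG : StronglyMeasurable[𝒜] G) (hGbound : ∀ ω, |G ω| ≤ C) (hY : Integrable Y P)
    (hcond : P[Y | 𝒜] =ᵐ[P] fun _ => μ) :
    P[fun ω => M ω + G ω * (Y ω - μ) | 𝒜] =ᵐ[P] M := by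
  have hcentred : Integrable (Y - fun _ => μ) P := hY.sub (integrable_const μ)
  have hproduct : Integrable (G * (Y - fun _ => μ)) P :=
    hcentred.bdd_mul (hG.mono h𝒜).aestronglyMeasurable (ae_of_all _ hGbound)
  have hsub := condExp_sub hY (integrable_const μ) 𝒜
  rw [condExp_const h𝒜] at hsub
  have hadd := condExp_add hMint hproduct 𝒜
  rw [condExp_of_stronglyMeasurable h𝒜 hM hMint] at hadd
  filter_upwards [hadd, condExp_mul_of_stronglyMeasurable_left hG hproduct hcentred, hsub, hcond]
    with ω hadd hmul hsub hcond
  rw [Pi.sub_apply, hcond, sub_self] at hsub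
  rw [Pi.mul_apply, hsub, mul_zero] at hmul
  rw [Pi.add_apply, hmul, add_zero] at hadd
  exact hadd

theorem integrable_of_mem_Icc [IsFiniteMeasure P] {Y : Ω → ℝ} (hmeas : Measurable Y)
    (hY : ∀ ω, Y ω ∈ Icc (0 : ℝ) 1) : Integrable Y P :=
  Integrable.of_mem_Icc 0 1 hmeas.aemeasurable (ae_of_all _ hY)

theorem mem_Icc_of_condExp_eq_const [IsProbabilityMeasure P] {𝒜 : MeasurableSpace Ω}
    (h𝒜 : 𝒜 ≤ m0) {Y : Ω → ℝ} {a b : ℝ} (hmeas : Measurable[m0] Y) (hY : ∀ ω, Y ω ∈ Icc a b)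
    (hcond : P[Y | 𝒜] =ᵐ[P] fun _ => μ) : μ ∈ Icc a b := by
  have hmean : ∫ ω, Y ω ∂P = μ := by
    rw [← integral_condExp h𝒜, integral_congr_ae hcond, integral_const, probReal_univ, one_smul]
  exact hmean ▸ (convex_Icc a b).integral_mem isClosed_Icc (ae_of_all _ hY)
    (Integrable.of_mem_Icc a b hmeas.aemeasurable (ae_of_all _ hY))

/-- The wealth of the mixture of constant betting fractions with weights `g`; the mixture
strategy of the theorem has `g = F`. -/
noncomputable def weightedWealth (g : ℝ → ℝ) (x : ℕ → ℝ) (t : ℕ) (m : ℝ) : ℝ :=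
  ∫ β in (-1 : ℝ)..1, wealth x t m β * g β

variable {g : ℝ → ℝ}

theorem stronglyMeasurable_weightedWealth (hg : Measurable g) {Y : ℕ → Ω → ℝ}
    (hY : ∀ i < t, Measurable (Y i)) :
    StronglyMeasurable fun ω => weightedWealth g (fun i => Y i ω) t m := by
  simp only [weightedWealth, intervalIntegral.integral_of_le (neg_le_self zero_le_one)]
  refine StronglyMeasurable.integral_prod_right'
    (f := fun p : Ω × ℝ => wealth (fun i => Y i p.1) t m p.2 * g p.2) ?_
  refine (Measurable.mul ?_ (hg.comp measurable_snd)).stronglyMeasurable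
  refine Finset.measurable_fun_prod _ fun i hi => ?_
  exact measurable_const.add (measurable_snd.mul
    (((hY i (Finset.mem_range.1 hi)).comp measurable_fst).sub measurable_const))

theorem abs_wealth_le (hx : ∀ i, x i ∈ Icc (0 : ℝ) 1) (hm : m ∈ Icc (0 : ℝ) 1) {β : ℝ}
    (hβ : |β| ≤ 1) : |wealth x t m β| ≤ 2 ^ t := by
  rw [abs_of_nonneg (wealth_nonneg hx hm hβ)]
  calc wealth x t m β ≤ ∏ _i ∈ Finset.range t, (2 : ℝ) := by
        refine Finset.prod_le_prod
          (fun i _ => one_add_mul_nonneg hβ (abs_sub_le_one hx hm i)) fun i _ => ?_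
        have habs : |β * (x i - m)| ≤ 1 := by
          rw [abs_mul]
          exact mul_le_one₀ hβ (abs_nonneg _) (abs_sub_le_one hx hm i)
        linarith [(abs_le.1 habs).2]
    _ = 2 ^ t := by rw [Finset.prod_const, Finset.card_range]

theorem abs_weightedWealth_le (hx : ∀ i, x i ∈ Icc (0 : ℝ) 1) (hm : m ∈ Icc (0 : ℝ) 1)
    (hg : IntervalIntegrable g volume (-1) 1) :
    |weightedWealth g x t m| ≤ 2 ^ t * ∫ β in (-1 : ℝ)..1, |g β| := by
  rw [← intervalIntegral.integral_const_mul, weightedWealth, ← norm_eq_abs]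
  refine intervalIntegral.norm_integral_le_of_norm_le (neg_le_self zero_le_one)
    (ae_of_all _ fun β hβ => ?_) (hg.abs.const_mul _)
  rw [norm_mul]
  exact mul_le_mul_of_nonneg_right (abs_wealth_le hx hm (abs_le.2 ⟨hβ.1.le, hβ.2⟩)) (abs_nonneg _)

theorem weightedWealth_succ (hg : IntervalIntegrable g volume (-1) 1) :
    weightedWealth g x (t + 1) m = weightedWealth g x t m
      + weightedWealth (fun β => β * g β) x t m * (x t - m) := by
  have hidg : IntervalIntegrable (fun β => β * g β) volume (-1) 1 :=
    hg.continuousOn_mul continuousOn_id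
  rw [weightedWealth, weightedWealth, weightedWealth, ← intervalIntegral.integral_mul_const,
    ← intervalIntegral.integral_add (intervalIntegrable_wealth_mul hg)
      ((intervalIntegrable_wealth_mul hidg).mul_const _)]
  refine intervalIntegral.integral_congr fun β _ => ?_
  simp only [wealth, Finset.prod_range_succ]
  ring

theorem integrable_weightedWealth [IsFiniteMeasure P] (hg : Measurable g)
    (hgint : IntervalIntegrable g volume (-1) 1) (hm : m ∈ Icc (0 : ℝ) 1) {Y : ℕ → Ω → ℝ}
    (hY : ∀ i ω, Y i ω ∈ Icc (0 : ℝ) 1) (hmeas : ∀ i < t, Measurable (Y i)) :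
    Integrable (fun ω => weightedWealth g (fun i => Y i ω) t m) P :=
  Integrable.of_bound (stronglyMeasurable_weightedWealth hg hmeas).aestronglyMeasurable _
    (ae_of_all _ fun ω => abs_weightedWealth_le (fun i => hY i ω) hm hgint)

theorem martingale_weightedWealth [IsFiniteMeasure P] (hg : Measurable g)
    (hgint : IntervalIntegrable g volume (-1) 1) {𝒢 : Filtration ℕ m0} {Y : ℕ → Ω → ℝ}
    (hμ : μ ∈ Icc (0 : ℝ) 1) (hY : ∀ i ω, Y i ω ∈ Icc (0 : ℝ) 1)
    (hadapted : ∀ i, Measurable[𝒢 (i + 1)] (Y i)) (hcond : ∀ i, P[Y i | 𝒢 i] =ᵐ[P] fun _ => μ) :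
    Martingale (fun t ω => weightedWealth g (fun i => Y i ω) t μ) 𝒢 P := by
  have hpast : ∀ t, ∀ i < t, Measurable[𝒢 t] (Y i) := fun t i hi =>
    (hadapted i).mono (𝒢.mono hi) le_rfl
  have hmeas : ∀ i, Measurable (Y i) := fun i => (hadapted i).mono (𝒢.le _) le_rfl
  have hM : ∀ t, StronglyMeasurable[𝒢 t] fun ω => weightedWealth g (fun i => Y i ω) t μ :=
    fun t => stronglyMeasurable_weightedWealth (m0 := 𝒢 t) hg (hpast t)
  have hMint : ∀ t, Integrable (fun ω => weightedWealth g (fun i => Y i ω) t μ) P :=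
    fun t => integrable_weightedWealth hg hgint hμ hY fun i _ => hmeas i
  refine martingale_nat hM hMint fun t => ?_
  simp only [weightedWealth_succ hgint]
  exact (condExp_add_mul_sub_const (𝒢.le t) (hM t) (hMint t)
    (stronglyMeasurable_weightedWealth (m0 := 𝒢 t) (measurable_id.mul hg) (hpast t))
    (fun ω => abs_weightedWealth_le (fun i => hY i ω) hμ (hgint.continuousOn_mul continuousOn_id))
    (integrable_of_mem_Icc (hmeas t) (hY t)) (hcond t)).symm

theorem mixtureWealth_zero : mixtureWealth x 0 m = 1 := by
  simp [mixtureWealth, wealth, integral_F]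

theorem mem_Icc_mLow_mUp (hδ : δ ∈ Ioo (0 : ℝ) 1) (hx : ∀ i, x i ∈ Icc (0 : ℝ) 1)
    (hm : m ∈ Icc (0 : ℝ) 1) (hacc : m ∈ accepted δ x t) :
    m ∈ Icc (mLow δ x t) (mUp δ x t) := by
  have hmuHat := muHat_mem_Icc hx t
  have hmuHatacc := muHat_mem_accepted (t := t) hδ hx
  have hbelow : BddBelow (Icc 0 (muHat x t) ∩ accepted δ x t) := ⟨0, fun y hy => hy.1.1⟩
  have habove : BddAbove (Icc (muHat x t) 1 ∩ accepted δ x t) := ⟨1, fun y hy => hy.1.2⟩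
  rcases le_total m (muHat x t) with hle | hle
  · exact ⟨csInf_le hbelow ⟨⟨hm.1, hle⟩, hacc⟩,
      hle.trans (le_csSup habove ⟨⟨le_rfl, hmuHat.2⟩, hmuHatacc⟩)⟩
  · exact ⟨(csInf_le hbelow ⟨⟨hmuHat.1, le_rfl⟩, hmuHatacc⟩).trans hle,
      le_csSup habove ⟨⟨hle, hm.2⟩, hacc⟩⟩

theorem mem_Icc_lower_upper (hδ : δ ∈ Ioo (0 : ℝ) 1) (hx : ∀ i, x i ∈ Icc (0 : ℝ) 1)
    (hm : m ∈ Icc (0 : ℝ) 1) (hacc : ∀ t, m ∈ accepted δ x t) (t : ℕ) :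
    m ∈ Icc (lower δ x t) (upper δ x t) := by
  induction t with
  | zero => exact hm
  | succ t ih =>
    have hmem := mem_Icc_mLow_mUp hδ hx hm (hacc (t + 1))
    exact ⟨max_le hmem.1 ih.1, le_min hmem.2 ih.2⟩

theorem measure_exists_notMem_Icc_lower_upper_le [IsProbabilityMeasure P]
    (hδ : δ ∈ Ioo (0 : ℝ) 1) {𝒢 : Filtration ℕ m0} {Y : ℕ → Ω → ℝ}
    (hY : ∀ i ω, Y i ω ∈ Icc (0 : ℝ) 1) (hadapted : ∀ i, Measurable[𝒢 (i + 1)] (Y i))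
    (hcond : ∀ i, P[Y i | 𝒢 i] =ᵐ[P] fun _ => μ) :
    P {ω | ∃ t, μ ∉ Icc (lower δ (fun i => Y i ω) t) (upper δ (fun i => Y i ω) t)}
      ≤ ENNReal.ofReal δ := by
  have hmeas : Measurable (Y 0) := (hadapted 0).mono (𝒢.le _) le_rfl
  have hμ : μ ∈ Icc (0 : ℝ) 1 :=
    mem_Icc_of_condExp_eq_const (𝒢.le 0) hmeas (hY 0) (hcond 0)
  have hmartingale : Martingale (fun t ω => mixtureWealth (fun i => Y i ω) t μ) 𝒢 P :=
    martingale_weightedWealth measurable_F intervalIntegrable_F hμ hY hadapted hcond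
  have hVille := ofReal_mul_measure_exists_lt_le hmartingale
    (fun t ω => mixtureWealth_nonneg (fun i => hY i ω) hμ) (1 / δ)
  simp only [mixtureWealth_zero, integral_const, probReal_univ, one_smul, ENNReal.ofReal_one,
    one_div, ENNReal.ofReal_inv_of_pos hδ.1] at hVille
  rw [mul_comm, ← div_eq_mul_inv, ENNReal.div_le_iff (ENNReal.ofReal_pos.2 hδ.1).ne'
    ENNReal.ofReal_ne_top, one_mul] at hVille
  refine le_trans (measure_mono ?_) hVille
  rintro ω ⟨t, ht⟩
  by_contra hno
  simp only [mem_ofPred_eq, not_exists, not_lt] at hno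
  exact ht (mem_Icc_lower_upper hδ (fun i => hY i ω) hμ (fun s =>
    mem_accepted_of_mixtureWealth_le hδ.1 (fun i => hY i ω) hμ (by rw [one_div]; exact hno s)) t)

/-- The filtration of the strict past: at time `i` it is generated by the `X j` with `j < i`. -/
def strictPast (X : ℕ → Ω → ℝ) (hX : ∀ i, Measurable (X i)) : Filtration ℕ m0 where
  seq i := ⨆ j < i, MeasurableSpace.comap (X j) inferInstance
  mono' _ _ hik := biSup_mono fun _ hj => hj.trans_le hik
  le' _ := iSup₂_le fun j _ => (hX j).comap_le

theorem coverage [IsProbabilityMeasure P] (hδ : δ ∈ Ioo (0 : ℝ) 1) {X : ℕ → Ω → ℝ}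
    (hX : ∀ i, Measurable (X i)) (hX01 : ∀ i, ∀ᵐ ω ∂P, X i ω ∈ Icc (0 : ℝ) 1)
    (hcond : ∀ i, P[X i | ⨆ j < i, MeasurableSpace.comap (X j) inferInstance] =ᵐ[P] fun _ => μ) :
    P {ω | ∃ t, μ ∉ Icc (lower δ (fun i => X i ω) t) (upper δ (fun i => X i ω) t)}
      ≤ ENNReal.ofReal δ := by
  let Y : ℕ → Ω → ℝ := fun i ω => projIcc 0 1 zero_le_one (X i ω)
  have hYX : ∀ i, Y i =ᵐ[P] X i := fun i =>
    (hX01 i).mono fun ω hω => congrArg Subtype.val (projIcc_of_mem zero_le_one hω)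
  have hadapted : ∀ i, Measurable[strictPast X hX (i + 1)] (Y i) := fun i =>
    (continuous_subtype_val.comp continuous_projIcc).measurable.comp
      ((comap_measurable (X i)).mono (le_iSup₂_of_le i i.lt_succ_self le_rfl) le_rfl)
  refine (measure_mono_ae ?_).trans (measure_exists_notMem_Icc_lower_upper_le hδ
    (fun i ω => (projIcc 0 1 zero_le_one (X i ω)).2) hadapted
    fun i => (condExp_congr_ae (hYX i)).trans (hcond i))
  filter_upwards [ae_all_iff.2 hYX] with ω hω
  have hsample : (fun i => Y i ω) = fun i => X i ω := funext hω
  intro hmiss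
  change ∃ t, μ ∉ Icc (lower δ (fun i => Y i ω) t) (upper δ (fun i => Y i ω) t)
  rwa [hsample]

end Coverage

/-! ### The Lambert function and the root of `exp u = K * √u` -/

section Lambert

variable {K u : ℝ}

theorem injOn_mul_exp_neg : InjOn (fun u : ℝ => u * exp (-u)) (Ici 1) := by
  intro u (hu : 1 ≤ u) v (hv : 1 ≤ v) huv
  have hlog := congrArg log huv
  simp only [log_mul (zero_lt_one.trans_le hu).ne' (exp_ne_zero _),
    log_mul (zero_lt_one.trans_le hv).ne' (exp_ne_zero _), log_exp] at hlog
  rcases lt_trichotomy u v with hlt | heq | hlt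
  · linarith [log_sub_log_lt hu hlt]
  · exact heq
  · linarith [log_sub_log_lt hv hlt]

theorem lambertWm1_neg_mul_exp_neg (hu : 1 ≤ u) : lambertWm1 (-u * exp (-u)) = -u := by
  have hsingleton : {w : ℝ | w ≤ -1 ∧ w * exp w = -u * exp (-u)} = {-u} := by
    ext w
    simp only [mem_ofPred_eq, mem_singleton_iff]
    constructor
    · rintro ⟨hw1, hw⟩
      have heq : -w = u := injOn_mul_exp_neg (le_neg_of_le_neg hw1) hu (by
        simp only [neg_neg]
        linarith)
      rw [← heq, neg_neg]
    · rintro rfl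
      exact ⟨neg_le_neg hu, rfl⟩
  rw [lambertWm1, hsingleton, csInf_singleton]

theorem exists_sub_half_log_eq {k : ℝ} (hk : 1 ≤ k) :
    ∃ u, 1 ≤ u ∧ u ≤ 2 * k ∧ u - 1 / 2 * log u = k := by
  have hcontinuous : ContinuousOn (fun u : ℝ => u - 1 / 2 * log u) (Icc 1 (2 * k)) :=
    continuousOn_id.sub (continuousOn_const.mul (continuousOn_log.mono fun u hu =>
      (zero_lt_one.trans_le hu.1).ne'))
  have hlog := log_le_sub_one_of_pos (x := 2 * k) (by linarith)
  obtain ⟨u, hu, heq⟩ := intermediate_value_Icc (by linarith) hcontinuous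
    (show k ∈ Icc _ _ from ⟨by simpa using hk, by linarith⟩)
  exact ⟨u, hu.1, hu.2, heq⟩

/-- The root `u ≥ 1` of `exp u = K * √u`, for `K ≥ e`. Squaring the equation turns it into
`w * exp w = -2 / K ^ 2` with `w = -2 * u`, whence the Lambert function. -/
noncomputable def expSqrtRoot (K : ℝ) : ℝ := -(1 / 2) * lambertWm1 (-2 / K ^ 2)

theorem expSqrtRoot_spec (hK : exp 1 ≤ K) :
    1 ≤ expSqrtRoot K ∧ expSqrtRoot K ≤ 2 * log K ∧
      expSqrtRoot K - 1 / 2 * log (expSqrtRoot K) = log K := by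
  have hK0 : 0 < K := (exp_pos 1).trans_le hK
  obtain ⟨u, hu1, hu2, heq⟩ := exists_sub_half_log_eq ((le_log_iff_exp_le hK0).2 hK)
  have hu0 : 0 < u := zero_lt_one.trans_le hu1
  have hexp : exp (2 * u) = u * K ^ 2 := by
    rw [show 2 * u = log u + 2 * log K by linarith, exp_add, exp_log hu0, two_mul, exp_add,
      exp_log hK0, sq]
  have harg : -2 / K ^ 2 = -(2 * u) * exp (-(2 * u)) := by
    rw [exp_neg, hexp]
    field_simp
  have hroot : expSqrtRoot K = u := by
    rw [expSqrtRoot, harg, lambertWm1_neg_mul_exp_neg (by linarith)]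
    ring
  rw [hroot]
  exact ⟨hu1, hu2, heq⟩

theorem one_le_expSqrtRoot (hK : exp 1 ≤ K) : 1 ≤ expSqrtRoot K := (expSqrtRoot_spec hK).1

theorem expSqrtRoot_le (hK : exp 1 ≤ K) : expSqrtRoot K ≤ 2 * log K := (expSqrtRoot_spec hK).2.1

theorem expSqrtRoot_eq (hK : exp 1 ≤ K) :
    expSqrtRoot K = log K + 1 / 2 * log (expSqrtRoot K) := by
  linarith [(expSqrtRoot_spec hK).2.2]

theorem le_expSqrtRoot (hK : exp 1 ≤ K) {L : ℝ} (hL0 : 0 < L) (hL : exp L ≤ K * √L) :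
    L ≤ expSqrtRoot K := by
  by_contra! hlt
  have hlog := log_le_log (exp_pos L) hL
  rw [log_exp, log_mul ((exp_pos 1).trans_le hK).ne' (sqrt_pos.2 hL0).ne', log_sqrt hL0.le]
    at hlog
  linarith [log_sub_log_lt (one_le_expSqrtRoot hK) hlt, expSqrtRoot_eq hK]

end Lambert

section U

variable {δ : ℝ} {x : ℕ → ℝ} {t : ℕ}

/-- The factor `K = (20 / (3δ)) h(1 / (2 + √(V_t / 2)))` for which `U_t` is the root of
`exp u = K * √u`. -/
noncomputable def UFactor (δ : ℝ) (x : ℕ → ℝ) (t : ℕ) : ℝ :=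
  20 / (3 * δ) * h (1 / (2 + √(VHat x t / 2)))

theorem one_div_two_add_sqrt_mem_Ioc (y : ℝ) : 1 / (2 + √y) ∈ Ioc (0 : ℝ) 1 := by
  have hsqrt := sqrt_nonneg y
  exact ⟨by positivity, (div_le_one (by positivity)).2 (by linarith)⟩

theorem exp_one_le_UFactor (hδ : δ ∈ Ioo (0 : ℝ) 1) : exp 1 ≤ UFactor δ x t := by
  have hδ0 := hδ.1
  calc exp 1 ≤ 20 / (3 * 1) * 4 := by linarith [exp_one_lt_d9]
    _ ≤ UFactor δ x t := by
        unfold UFactor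
        gcongr
        · exact hδ.2.le
        · exact four_le_h (one_div_two_add_sqrt_mem_Ioc _)

theorem UFactor_pos (hδ : δ ∈ Ioo (0 : ℝ) 1) : 0 < UFactor δ x t :=
  (exp_pos 1).trans_le (exp_one_le_UFactor hδ)

theorem U_eq_expSqrtRoot : U δ x t = expSqrtRoot (UFactor δ x t) := rfl

theorem one_le_U (hδ : δ ∈ Ioo (0 : ℝ) 1) : 1 ≤ U δ x t :=
  one_le_expSqrtRoot (exp_one_le_UFactor hδ)

end U

/-! ### Growth of the maximal wealth away from the empirical mean -/

/-- The absolute deviation `t * |μ̂_t - m| = |∑ (x_i - m)|`. -/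
noncomputable def deviation (x : ℕ → ℝ) (t : ℕ) (m : ℝ) : ℝ := t * |muHat x t - m|

section Growth

variable {x : ℕ → ℝ} {t : ℕ} {m : ℝ}

theorem V_eq_VHat_add (x : ℕ → ℝ) (t : ℕ) (m : ℝ) :
    V x t m = VHat x t + t * (muHat x t - m) ^ 2 := by
  have hexpand : ∀ i, (x i - m) ^ 2 = (x i - muHat x t) ^ 2
      + 2 * (muHat x t - m) * (x i - muHat x t) + (muHat x t - m) ^ 2 := fun i => by ring
  simp only [V, VHat, hexpand, Finset.sum_add_distrib, ← Finset.mul_sum, sum_sub_eq x t (muHat x t),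
    sub_self, mul_zero, add_zero, Finset.sum_const, Finset.card_range, nsmul_eq_mul]

theorem VHat_nonneg : 0 ≤ VHat x t := V_nonneg

theorem deviation_nonneg : 0 ≤ deviation x t m := mul_nonneg t.cast_nonneg (abs_nonneg _)

theorem sum_sign_mul_sub (x : ℕ → ℝ) (t : ℕ) (m : ℝ) :
    ∑ i ∈ Finset.range t, sign (muHat x t - m) * (x i - m) = deviation x t m := by
  rw [← Finset.mul_sum, sum_sub_eq, deviation, mul_left_comm]
  congr 1
  nth_rw 2 [← abs_mul_sign_self (muHat x t - m)]
  rw [mul_left_comm]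
  rcases eq_or_ne (muHat x t - m) 0 with h0 | h0
  · rw [h0, abs_zero, zero_mul]
  · rw [sign_mul_sign_self h0, mul_one]

theorem log_wealthStar_nonneg : 0 ≤ log (wealthStar x t m) := log_nonneg one_le_wealthStar

theorem log_wealthStar_ge (hx : ∀ i, x i ∈ Icc (0 : ℝ) 1) (hm : m ∈ Icc (0 : ℝ) 1) :
    deviation x t m ^ 2 / (2 * (V x t m + 2 / 3 * deviation x t m))
      ≤ log (wealthStar x t m) := by
  rcases (deviation_nonneg (x := x) (t := t) (m := m)).eq_or_lt with hS | hS
  · simpa [← hS] using log_wealthStar_nonneg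
  have hsign : sign (muHat x t - m) * sign (muHat x t - m) = 1 :=
    sign_mul_sign_self fun h0 => by simp [deviation, h0] at hS
  have hV : ∑ i ∈ Finset.range t, (sign (muHat x t - m) * (x i - m)) ^ 2 = V x t m := by
    simp only [V, mul_pow, sq (sign _), hsign, one_mul]
  have hcoin : ∀ i ∈ Finset.range t, -1 ≤ sign (muHat x t - m) * (x i - m) := fun i _ =>
    (abs_le.1 ((abs_mul _ _).trans_le
      (mul_le_one₀ (abs_sign_le_one _) (abs_nonneg _) (abs_sub_le_one hx hm i)))).1
  obtain ⟨u, hu, hpos, hle⟩ :=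
    exists_log_coinWealth_ge hcoin ((sum_sign_mul_sub x t m).symm ▸ hS)
  rw [sum_sign_mul_sub, hV] at hle
  refine hle.trans (log_le_log hpos ?_)
  rw [coinWealth_mul_coins]
  refine wealth_le_wealthStar ?_
  rw [abs_mul, abs_of_nonneg hu.1]
  exact mul_le_one₀ hu.2 (abs_nonneg _) (abs_sign_le_one _)

theorem betaStar_mul_pos (hx : ∀ i, x i ∈ Icc (0 : ℝ) 1) (hm : m ∈ Icc (0 : ℝ) 1)
    (hS : 0 < deviation x t m) : 0 < betaStar x t m * (muHat x t - m) := by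
  have hV := V_nonneg (x := x) (t := t) (m := m)
  have hpos : 0 < log (wealthStar x t m) :=
    lt_of_lt_of_le (by positivity) (log_wealthStar_ge hx hm)
  have hlog := log_le_log wealthStar_pos
    (show wealthStar x t m ≤ _ from wealth_le_exp hx hm abs_betaStar_le_one)
  rw [log_exp, sum_sub_eq, mul_left_comm] at hlog
  exact pos_of_mul_pos_right (hpos.trans_le hlog) t.cast_nonneg

theorem betaStar_ne_zero (hx : ∀ i, x i ∈ Icc (0 : ℝ) 1) (hm : m ∈ Icc (0 : ℝ) 1)
    (hS : 0 < deviation x t m) : betaStar x t m ≠ 0 :=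
  left_ne_zero_of_mul (betaStar_mul_pos hx hm hS).ne'

theorem sum_coin (hx : ∀ i, x i ∈ Icc (0 : ℝ) 1) (hm : m ∈ Icc (0 : ℝ) 1)
    (hS : 0 < deviation x t m) :
    ∑ i ∈ Finset.range t, coin x t m i = deviation x t m := by
  rw [← sum_sign_mul_sub]
  refine Finset.sum_congr rfl fun i _ => ?_
  rcases pos_and_pos_or_neg_and_neg_of_mul_pos (betaStar_mul_pos hx hm hS) with ⟨hβ, hd⟩ | ⟨hβ, hd⟩
  · rw [coin, sign_of_pos hβ, sign_of_pos hd]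
  · rw [coin, sign_of_neg hβ, sign_of_neg hd]

theorem V_le_deviation_mul (hx : ∀ i, x i ∈ Icc (0 : ℝ) 1) (hm : m ∈ Icc (0 : ℝ) 1)
    (hSV : √(2 * VHat x t) ≤ deviation x t m) :
    V x t m ≤ deviation x t m * (1 + √(VHat x t / 2)) := by
  have hV := VHat_nonneg (x := x) (t := t)
  have hVHat : VHat x t ≤ deviation x t m * √(VHat x t / 2) :=
    calc VHat x t = √(2 * VHat x t) * √(VHat x t / 2) := by
          rw [← sqrt_mul (by positivity),
            show 2 * VHat x t * (VHat x t / 2) = VHat x t ^ 2 by ring, sqrt_sq hV]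
      _ ≤ _ := by gcongr
  have hsq : t * (muHat x t - m) ^ 2 ≤ deviation x t m := by
    rw [← sq_abs, deviation]
    gcongr
    exact sq_le (abs_nonneg _) (abs_sub_le_one (fun _ => muHat_mem_Icc hx t) hm 0)
  rw [V_eq_VHat_add]
  linarith

theorem one_div_le_abs_betaStar (hx : ∀ i, x i ∈ Icc (0 : ℝ) 1) (hm : m ∈ Icc (0 : ℝ) 1)
    (hS : 0 < deviation x t m) (hSV : √(2 * VHat x t) ≤ deviation x t m) :
    1 / (2 + √(VHat x t / 2)) ≤ |betaStar x t m| := by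
  rcases abs_betaStar_le_one.eq_or_lt (a := |betaStar x t m|) with h1 | h1
  · rw [h1]
    exact (one_div_two_add_sqrt_mem_Ioc _).2
  have hsum := sum_mul_one_sub_le (fun i _ => (abs_le.1 (abs_coin_le_one (t := t) hx hm i)).1)
    (abs_nonneg _) h1 (score_coin_eq_zero h1)
  rw [sum_coin hx hm hS, ← V_eq_sum_coin_sq (betaStar_ne_zero hx hm hS)] at hsum
  have hV := mul_le_mul_of_nonneg_left (V_le_deviation_mul hx hm hSV) (abs_nonneg (betaStar x t m))
  rw [div_le_iff₀ (by positivity)]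
  refine le_of_mul_le_mul_left ?_ hS
  linarith

theorem h_abs_betaStar_le (hx : ∀ i, x i ∈ Icc (0 : ℝ) 1) (hm : m ∈ Icc (0 : ℝ) 1)
    (hS : 0 < deviation x t m) (hSV : √(2 * VHat x t) ≤ deviation x t m) :
    h |betaStar x t m| ≤ h (1 / (2 + √(VHat x t / 2))) :=
  antitoneOn_h (one_div_two_add_sqrt_mem_Ioc _)
    ⟨abs_pos.2 (betaStar_ne_zero hx hm hS), abs_betaStar_le_one⟩
    (one_div_le_abs_betaStar hx hm hS hSV)

end Growth

/-! ### Accepted means with a large bet -/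

section LargeBet

variable {x : ℕ → ℝ} {t : ℕ} {m δ : ℝ}

theorem h_le_fifteen {y : ℝ} (hy : y ∈ Icc (2 / 5) 1) : h y ≤ 15 := by
  have hmem : (2 / 5 : ℝ) ∈ Ioc 0 1 := by norm_num
  have hlog : log (c / (2 / 5)) ≤ 4 := by
    rw [log_le_iff_le_exp (div_pos c_pos (by norm_num)), show (4 : ℝ) = (4 : ℕ) * 1 by norm_num,
      exp_nat_mul, c]
    nlinarith [exp_one_gt_d9, exp_one_lt_d9, sq_nonneg (exp 1 ^ 2 - 2.7 ^ 2),
      sq_nonneg (exp 1 - 2.7)]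
  have hloglog : log (log (c / (2 / 5))) ≤ 1.4 := by
    refine (log_le_log (log_c_div_pos hmem) hlog).trans ?_
    rw [show (4 : ℝ) = 2 ^ 2 by norm_num, log_pow]
    push_cast
    linarith [log_two_lt_d9]
  have hconst : 2 / log (log c) ≤ 1.9 := by
    rw [div_le_iff₀ log_log_c_pos]
    linarith [le_log_log_c]
  have := (log_c_div_pos hmem).le
  have := (log_log_c_div_pos hmem).le
  calc h y ≤ h (2 / 5) := antitoneOn_h hmem ⟨by linarith [hy.1], hy.2⟩ hy.1
    _ ≤ 1.9 * 4 * 1.4 ^ 2 := by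
        unfold h
        gcongr
    _ ≤ 15 := by norm_num

theorem mul_le_exp_half {L : ℝ} (hL : 17 ≤ L) : 24 * L ≤ exp (L / 2) := by
  have hpow : (2.7 : ℝ) ^ 8 ≤ exp 1 ^ 8 := by
    gcongr
    linarith [exp_one_gt_d9]
  calc 24 * L ≤ 2.7 ^ 8 * (L / 2 - 8 + 1) := by
        norm_num
        linarith
    _ ≤ exp 1 ^ 8 * exp (L / 2 - 8) := by
        gcongr
        · linarith
        · exact add_one_le_exp _
    _ = exp (L / 2) := by
        rw [← exp_nat_mul, ← exp_add]
        congr 1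
        push_cast
        ring

theorem wealthStar_le_mul_log (hδ : 0 < δ) (h0 : betaStar x t m ≠ 0) (hacc : m ∈ accepted δ x t)
    (hW : 8 / 3 ≤ wealthStar x t m) :
    wealthStar x t m ≤ 8 / 5 * log (wealthStar x t m) * h |betaStar x t m| / δ := by
  have hb0 := abs_pos.2 h0
  have hh := h_pos ⟨hb0, abs_betaStar_le_one⟩
  have hL : 0 < log (wealthStar x t m) := log_pos (by linarith)
  have hF := F_pos h0 abs_betaStar_le_one
  have hle : wealthStar x t m * (logRatio (wealthStar x t m) * |betaStar x t m|
      * F (betaStar x t m)) ≤ 1 / δ := by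
    refine le_trans ?_ ((mem_accepted_iff hδ h0).1 hacc)
    unfold invR
    gcongr
    exact le_max_left _ _
  have heq : wealthStar x t m * (logRatio (wealthStar x t m) * |betaStar x t m|
      * F (betaStar x t m))
        = (wealthStar x t m - 1) / (log (wealthStar x t m) * h |betaStar x t m|) := by
    rw [logRatio, if_neg (by linarith), F]
    field_simp
  rw [heq, div_le_div_iff₀ (by positivity) hδ] at hle
  rw [le_div_iff₀ hδ]
  nlinarith

theorem eight_div_three_le_of_one_le_log (hL : 1 ≤ log (wealthStar x t m)) :
    8 / 3 ≤ wealthStar x t m := by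
  linarith [exp_one_gt_d9, (le_log_iff_exp_le wealthStar_pos).1 hL]

theorem log_wealthStar_le_U (hδ : δ ∈ Ioo (0 : ℝ) 1) (hL : 1 ≤ log (wealthStar x t m))
    (hle : wealthStar x t m ≤ UFactor δ x t * √(log (wealthStar x t m))) :
    log (wealthStar x t m) ≤ U δ x t :=
  le_expSqrtRoot (exp_one_le_UFactor hδ) (by linarith) (by rwa [exp_log wealthStar_pos])

-- `20 / 3 = 8 / 5 * (25 / 6)` is the constant in `U`.
theorem log_wealthStar_le_U_of_sqrt_le (hδ : δ ∈ Ioo (0 : ℝ) 1) (h0 : betaStar x t m ≠ 0)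
    (hacc : m ∈ accepted δ x t) (hh : h |betaStar x t m| ≤ h (1 / (2 + √(VHat x t / 2))))
    (hL : 1 ≤ log (wealthStar x t m)) (hsqrt : √(log (wealthStar x t m)) ≤ 25 / 6) :
    log (wealthStar x t m) ≤ U δ x t := by
  have hδ0 := hδ.1
  have hpos := h_pos ⟨abs_pos.2 h0, abs_betaStar_le_one⟩
  have hsq := mul_self_sqrt (zero_le_one.trans hL)
  refine log_wealthStar_le_U hδ hL ?_
  calc wealthStar x t m
      ≤ 8 / 5 * log (wealthStar x t m) * h |betaStar x t m| / δ :=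
        wealthStar_le_mul_log hδ0 h0 hacc (eight_div_three_le_of_one_le_log hL)
    _ = 8 / 5 * (√(log (wealthStar x t m)) * √(log (wealthStar x t m)))
          * h |betaStar x t m| / δ := by rw [hsq]
    _ ≤ 8 / 5 * (25 / 6 * √(log (wealthStar x t m))) * h (1 / (2 + √(VHat x t / 2))) / δ := by
        gcongr
    _ = UFactor δ x t * √(log (wealthStar x t m)) := by
        rw [UFactor]
        field_simp
        ring

theorem log_wealthStar_le_two_mul_log (hδ : 0 < δ) (hacc : m ∈ accepted δ x t)
    (hb : 2 / 5 ≤ |betaStar x t m|) (hL : 17 ≤ log (wealthStar x t m)) :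
    log (wealthStar x t m) ≤ 2 * log (1 / δ) := by
  have h0 : betaStar x t m ≠ 0 := abs_pos.1 (by linarith)
  have hW : exp (log (wealthStar x t m)) ≤ exp (log (wealthStar x t m) / 2) / δ := by
    rw [exp_log wealthStar_pos]
    refine (wealthStar_le_mul_log hδ h0 hacc
      (eight_div_three_le_of_one_le_log (by linarith))).trans ?_
    gcongr
    refine le_trans ?_ (mul_le_exp_half hL)
    nlinarith [h_le_fifteen ⟨hb, abs_betaStar_le_one⟩]
  have hlog := log_le_log (exp_pos _) hW
  rw [log_div (exp_ne_zero _) hδ.ne', log_exp, log_exp] at hlog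
  rw [one_div, log_inv]
  linarith

theorem abs_betaStar_mul_V_le (hx : ∀ i, x i ∈ Icc (0 : ℝ) 1) (hm : m ∈ Icc (0 : ℝ) 1)
    (hS : 0 < deviation x t m) : |betaStar x t m| * V x t m ≤ 2 * deviation x t m := by
  have h0 := betaStar_ne_zero hx hm hS
  have hpos : ∀ i ∈ Finset.range t, 0 < 1 + |betaStar x t m| * coin x t m i := fun i hi =>
    (one_add_mul_nonneg (by rw [abs_abs]; exact abs_betaStar_le_one)
      (abs_coin_le_one hx hm i)).lt_of_ne' (one_add_mul_ne_zero_of_isMaxOn isMaxOn_abs_betaStar hi)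
  rw [V_eq_sum_coin_sq h0, ← sum_coin hx hm hS]
  exact mul_sum_sq_le (fun i _ => (abs_le.1 (abs_coin_le_one hx hm i)).2) (abs_nonneg _)
    abs_betaStar_le_one hpos
    (score_nonneg_of_isMaxOn (abs_pos.2 h0) abs_betaStar_le_one isMaxOn_abs_betaStar)

theorem mul_deviation_le_log_wealthStar (hx : ∀ i, x i ∈ Icc (0 : ℝ) 1)
    (hm : m ∈ Icc (0 : ℝ) 1) (hS : 0 < deviation x t m) (hb : 9 / 20 ≤ |betaStar x t m|) :
    9 / 92 * deviation x t m ≤ log (wealthStar x t m) := by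
  have hV0 := V_nonneg (x := x) (t := t) (m := m)
  have hV : V x t m ≤ 40 / 9 * deviation x t m := by
    nlinarith [abs_betaStar_mul_V_le hx hm hS]
  refine le_trans ?_ (log_wealthStar_ge hx hm)
  rw [le_div_iff₀ (by positivity)]
  nlinarith

theorem log_wealthStar_le_U_or_deviation_le (hδ : δ ∈ Ioo (0 : ℝ) 1)
    (hx : ∀ i, x i ∈ Icc (0 : ℝ) 1) (hm : m ∈ Icc (0 : ℝ) 1) (hS : 0 < deviation x t m)
    (hacc : m ∈ accepted δ x t) (hSV : √(2 * VHat x t) ≤ deviation x t m)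
    (hL : 1 ≤ log (wealthStar x t m)) (hb : 9 / 20 ≤ |betaStar x t m|) :
    log (wealthStar x t m) ≤ U δ x t ∨ deviation x t m ≤ 24 * log (7 / (6 * δ)) := by
  have hδ0 := hδ.1
  rcases le_or_gt √(log (wealthStar x t m)) (25 / 6) with hsqrt | hsqrt
  · exact .inl (log_wealthStar_le_U_of_sqrt_le hδ (betaStar_ne_zero hx hm hS) hacc
      (h_abs_betaStar_le hx hm hS hSV) hL hsqrt)
  · right
    have hlog : log (1 / δ) ≤ log (7 / (6 * δ)) := by
      refine log_le_log (by positivity) ?_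
      rw [div_le_div_iff₀ hδ0 (by positivity)]
      linarith
    have hL17 : 17 ≤ log (wealthStar x t m) := by nlinarith [sq_sqrt (zero_le_one.trans hL)]
    linarith [log_wealthStar_le_two_mul_log hδ0 hacc (by linarith) hL17,
      mul_deviation_le_log_wealthStar hx hm hS hb]

end LargeBet

/-! ### Accepted means with a small bet -/

section SmallBet

variable {x : ℕ → ℝ} {t : ℕ} {m δ : ℝ}

theorem log_wealthStar_le_div_d (hx : ∀ i, x i ∈ Icc (0 : ℝ) 1) (hm : m ∈ Icc (0 : ℝ) 1)
    (h0 : betaStar x t m ≠ 0) (h1 : |betaStar x t m| < 1) :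
    log (wealthStar x t m) ≤ |betaStar x t m| ^ 2 * V x t m / (2 * d x t m ^ 2) := by
  have hle := wealthStar_mul_exp_le_coinWealth hx hm h0 h1 (left_mem_Icc.2 (abs_nonneg _))
  rw [coinWealth_zero, sub_zero, neg_div, exp_neg, ← div_eq_mul_inv, div_le_one (exp_pos _)] at hle
  exact (log_le_iff_le_exp wealthStar_pos).2 hle

theorem Delta_eq_of_one_le_log (hx : ∀ i, x i ∈ Icc (0 : ℝ) 1) (hm : m ∈ Icc (0 : ℝ) 1)
    (h0 : betaStar x t m ≠ 0) (h1 : |betaStar x t m| < 1) (hL : 1 ≤ log (wealthStar x t m)) :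
    0 < √(V x t m) ∧ Delta x t m = d x t m / √(V x t m) := by
  have hd : 0 < d x t m := (sub_pos.2 h1).trans_le (one_sub_abs_betaStar_le_d hx hm)
  have hle := hL.trans (log_wealthStar_le_div_d hx hm h0 h1)
  rw [le_div_iff₀ (by positivity), one_mul] at hle
  have hV : 0 < V x t m := pos_of_mul_pos_right (lt_of_lt_of_le (by positivity) hle) (by positivity)
  have hsV := sqrt_pos.2 hV
  have hle' : d x t m / √(V x t m) ≤ |betaStar x t m| := by
    rw [div_le_iff₀ hsV]
    refine le_of_sq_le_sq ?_ (by positivity)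
    rw [mul_pow, sq_sqrt hV.le]
    linarith [sq_nonneg (d x t m)]
  refine ⟨hsV, ?_⟩
  rw [Delta, deltaTilde, if_pos h1, max_eq_left (by linarith), sub_sub_cancel]

theorem wealthStar_le_mul_sqrt_V (hδ : 0 < δ) (hx : ∀ i, x i ∈ Icc (0 : ℝ) 1)
    (hm : m ∈ Icc (0 : ℝ) 1) (h0 : betaStar x t m ≠ 0) (h1 : |betaStar x t m| < 1)
    (hacc : m ∈ accepted δ x t) (hL : 1 ≤ log (wealthStar x t m)) :
    wealthStar x t m
      ≤ exp (1 / 2) * (|betaStar x t m| * √(V x t m)) * h |betaStar x t m| / d x t m / δ := by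
  have hb0 := abs_pos.2 h0
  have hd : 0 < d x t m := (sub_pos.2 h1).trans_le (one_sub_abs_betaStar_le_d hx hm)
  obtain ⟨hsV, hDelta⟩ := Delta_eq_of_one_le_log hx hm h0 h1 hL
  have hh := h_pos ⟨hb0, h1.le⟩
  have hF := F_pos h0 h1.le
  have hexp : -(Delta x t m ^ 2 * V x t m) / (2 * d x t m ^ 2) = -(1 / 2) := by
    rw [hDelta, div_pow, sq_sqrt (sqrt_pos.1 hsV).le]
    have := (sqrt_pos.1 hsV).ne'
    field_simp
  have hW := wealthStar_pos (x := x) (t := t) (m := m)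
  have hle : wealthStar x t m * (exp (-(1 / 2)) * (d x t m / √(V x t m)) * F (betaStar x t m))
      ≤ 1 / δ := by
    refine le_trans ?_ ((mem_accepted_iff hδ h0).1 hacc)
    unfold invR
    gcongr
    rw [hexp, hDelta]
    exact le_max_right _ _
  rw [F, exp_neg] at hle
  calc wealthStar x t m
      = wealthStar x t m * ((exp (1 / 2))⁻¹ * (d x t m / √(V x t m))
            * (1 / (|betaStar x t m| * h |betaStar x t m|)))
          * (exp (1 / 2) * (|betaStar x t m| * √(V x t m)) * h |betaStar x t m| / d x t m) := by
        have := exp_ne_zero (1 / 2)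
        field_simp
    _ ≤ 1 / δ
          * (exp (1 / 2) * (|betaStar x t m| * √(V x t m)) * h |betaStar x t m| / d x t m) := by
        gcongr
    _ = _ := by ring

theorem abs_betaStar_mul_sqrt_V_le (hx : ∀ i, x i ∈ Icc (0 : ℝ) 1) (hm : m ∈ Icc (0 : ℝ) 1)
    (h0 : betaStar x t m ≠ 0) (h1 : |betaStar x t m| < 1) :
    |betaStar x t m| * √(V x t m)
      ≤ √2 * (1 + |betaStar x t m|) * √(log (wealthStar x t m)) := by
  have hlog := sq_mul_sum_sq_le_log_coinWealth (fun i _ => abs_coin_le_one (t := t) hx hm i)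
    (abs_nonneg _) h1 (score_coin_eq_zero h1)
  rw [coinWealth_coin_abs_betaStar, ← V_eq_sum_coin_sq h0, div_le_iff₀ (by positivity)] at hlog
  refine le_of_sq_le_sq ?_ (by positivity)
  rw [mul_pow, sq_sqrt V_nonneg, mul_pow, mul_pow, sq_sqrt (by norm_num),
    sq_sqrt log_wealthStar_nonneg]
  linarith

theorem exp_half_mul_sqrt_two_le : exp (1 / 2) * √2 ≤ 2.4 := by
  refine le_of_sq_le_sq ?_ (by norm_num)
  rw [mul_pow, sq_sqrt (by norm_num), ← exp_nat_mul]
  norm_num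
  linarith [exp_one_lt_d9]

-- For `|β*| < 9 / 20` the constants combine to `2.4 * (29 / 11) ≤ 20 / 3`.
theorem log_wealthStar_le_U_of_small_bet (hδ : δ ∈ Ioo (0 : ℝ) 1)
    (hx : ∀ i, x i ∈ Icc (0 : ℝ) 1) (hm : m ∈ Icc (0 : ℝ) 1) (hS : 0 < deviation x t m)
    (hacc : m ∈ accepted δ x t) (hSV : √(2 * VHat x t) ≤ deviation x t m)
    (hL : 1 ≤ log (wealthStar x t m)) (hb : |betaStar x t m| < 9 / 20) :
    log (wealthStar x t m) ≤ U δ x t := by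
  have hδ0 := hδ.1
  have h0 := betaStar_ne_zero hx hm hS
  have h1 : |betaStar x t m| < 1 := by linarith
  have hd := one_sub_abs_betaStar_le_d (t := t) hx hm
  have hd0 : 0 < d x t m := by linarith
  have hratio : (1 + |betaStar x t m|) / d x t m ≤ 29 / 11 := by
    rw [div_le_div_iff₀ hd0 (by norm_num)]
    linarith
  have hpos := h_pos ⟨abs_pos.2 h0, h1.le⟩
  have hpos' := h_pos (one_div_two_add_sqrt_mem_Ioc (VHat x t / 2))
  refine log_wealthStar_le_U hδ hL ?_
  set H := h (1 / (2 + √(VHat x t / 2))) with hH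
  calc wealthStar x t m
      ≤ exp (1 / 2) * (|betaStar x t m| * √(V x t m)) * h |betaStar x t m| / d x t m / δ :=
        wealthStar_le_mul_sqrt_V hδ0 hx hm h0 h1 hacc hL
    _ ≤ exp (1 / 2) * (√2 * (1 + |betaStar x t m|) * √(log (wealthStar x t m))) * H
          / d x t m / δ := by
        have hbV := abs_betaStar_mul_sqrt_V_le (t := t) hx hm h0 h1
        have hh : h |betaStar x t m| ≤ H := h_abs_betaStar_le hx hm hS hSV
        gcongr exp (1 / 2) * ?_ * ?_ / d x t m / δ
    _ = exp (1 / 2) * √2 * ((1 + |betaStar x t m|) / d x t m)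
          * (H * √(log (wealthStar x t m)) / δ) := by field_simp
    _ ≤ 2.4 * (29 / 11) * (H * √(log (wealthStar x t m)) / δ) := by
        gcongr
        exact exp_half_mul_sqrt_two_le
    _ ≤ 20 / 3 * (H * √(log (wealthStar x t m)) / δ) := by
        gcongr
        norm_num
    _ = UFactor δ x t * √(log (wealthStar x t m)) := by
        rw [UFactor, ← hH]
        field_simp

end SmallBet

/-! ### Width of the confidence sequence -/

section Width

variable {x : ℕ → ℝ} {t : ℕ} {m δ : ℝ}

/-- The factor `U_t / (1 - 2 * U_t / t)` of the width, meaningful for `2 * U_t < t`. -/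
noncomputable def inflatedU (δ : ℝ) (x : ℕ → ℝ) (t : ℕ) : ℝ := U δ x t / (1 - 2 * U δ x t / t)

theorem natCast_pos_of_two_mul_U_lt (hδ : δ ∈ Ioo (0 : ℝ) 1) (hU : 2 * U δ x t < t) :
    (0 : ℝ) < t := by
  linarith [one_le_U (x := x) (t := t) hδ]

theorem one_sub_two_mul_U_div_pos (hδ : δ ∈ Ioo (0 : ℝ) 1) (hU : 2 * U δ x t < t) :
    0 < 1 - 2 * U δ x t / t :=
  sub_pos.2 ((div_lt_one (natCast_pos_of_two_mul_U_lt hδ hU)).2 hU)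

theorem inflatedU_mul (hδ : δ ∈ Ioo (0 : ℝ) 1) (hU : 2 * U δ x t < t) :
    inflatedU δ x t * (1 - 2 * U δ x t / t) = U δ x t :=
  div_mul_cancel₀ _ (one_sub_two_mul_U_div_pos hδ hU).ne'

theorem one_le_inflatedU (hδ : δ ∈ Ioo (0 : ℝ) 1) (hU : 2 * U δ x t < t) :
    1 ≤ inflatedU δ x t := by
  have hU1 := one_le_U (x := x) (t := t) hδ
  have hnonneg : 0 ≤ 2 * U δ x t / t := by positivity
  rw [inflatedU, le_div_iff₀ (one_sub_two_mul_U_div_pos hδ hU)]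
  linarith

theorem widthBound_eq (hδ : δ ∈ Ioo (0 : ℝ) 1) (hU : 2 * U δ x t < t) :
    widthBound δ x t = (√(inflatedU δ x t * (2 * VHat x t)) + 4 / 3 * inflatedU δ x t
      + 24 * log (7 / (6 * δ))) / t := by
  have ht := natCast_pos_of_two_mul_U_lt hδ hU
  have : (t : ℝ) - 2 * U δ x t ≠ 0 := (sub_pos.2 hU).ne'
  have hmiddle : 4 / 3 * U δ x t / (t - 2 * U δ x t) = 4 / 3 * inflatedU δ x t / t := by
    rw [inflatedU, one_sub_div ht.ne']
    field_simp
  rw [widthBound, ← inflatedU, max_eq_left (one_le_inflatedU hδ hU), hmiddle]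
  ring

theorem log_seven_div_pos (hδ : δ ∈ Ioo (0 : ℝ) 1) : 0 < log (7 / (6 * δ)) := by
  refine log_pos ?_
  rw [lt_div_iff₀ (by linarith [hδ.1])]
  linarith [hδ.2]

theorem mul_add_mul_lt_sq {u v S : ℝ} (hu : 0 ≤ u) (hv : 0 ≤ v) (hlt : √(u * v) + 4 / 3 * u < S) :
    u * v + 4 / 3 * u * S < S ^ 2 := by
  nlinarith [sq_sqrt (mul_nonneg hu hv), sqrt_nonneg (u * v)]

theorem U_lt_log_wealthStar (hδ : δ ∈ Ioo (0 : ℝ) 1) (hx : ∀ i, x i ∈ Icc (0 : ℝ) 1)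
    (hm : m ∈ Icc (0 : ℝ) 1) (hU : 2 * U δ x t < t)
    (hlt : √(inflatedU δ x t * (2 * VHat x t)) + 4 / 3 * inflatedU δ x t < deviation x t m) :
    U δ x t < log (wealthStar x t m) := by
  have ht := natCast_pos_of_two_mul_U_lt hδ hU
  have hu1 := one_le_inflatedU hδ hU
  have hV := VHat_nonneg (x := x) (t := t)
  have hS : 0 < deviation x t m := lt_of_le_of_lt (by positivity) hlt
  refine lt_of_lt_of_le ?_ (log_wealthStar_ge hx hm)
  have hVS : V x t m = VHat x t + deviation x t m ^ 2 / t := by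
    rw [V_eq_VHat_add, ← sq_abs, deviation]
    field_simp
  rw [hVS, lt_div_iff₀ (by positivity)]
  have hmul := mul_lt_mul_of_pos_right
    (mul_add_mul_lt_sq (by linarith) (by linarith : 0 ≤ 2 * VHat x t) hlt)
    (one_sub_two_mul_U_div_pos hδ hU)
  have hleft : (inflatedU δ x t * (2 * VHat x t) + 4 / 3 * inflatedU δ x t * deviation x t m)
      * (1 - 2 * U δ x t / t) = U δ x t * (2 * VHat x t + 4 / 3 * deviation x t m) :=
    calc _ = inflatedU δ x t * (1 - 2 * U δ x t / t)
          * (2 * VHat x t + 4 / 3 * deviation x t m) := by ring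
      _ = _ := by rw [inflatedU_mul hδ hU]
  rw [hleft] at hmul
  linarith [show deviation x t m ^ 2 * (1 - 2 * U δ x t / t)
    = deviation x t m ^ 2 - U δ x t * (2 * (deviation x t m ^ 2 / t)) by field_simp]

theorem width_of_accepted (hδ : δ ∈ Ioo (0 : ℝ) 1) (hx : ∀ i, x i ∈ Icc (0 : ℝ) 1)
    (hm : m ∈ Icc (0 : ℝ) 1) (hU : 2 * U δ x t < t) (hacc : m ∈ accepted δ x t) :
    |muHat x t - m| ≤ widthBound δ x t := by
  have hu1 := one_le_inflatedU hδ hU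
  have hlog := log_seven_div_pos hδ
  have hV := VHat_nonneg (x := x) (t := t)
  rw [widthBound_eq hδ hU, le_div_iff₀ (natCast_pos_of_two_mul_U_lt hδ hU), mul_comm]
  by_contra! hlt
  change _ < deviation x t m at hlt
  have hsqrt := sqrt_nonneg (inflatedU δ x t * (2 * VHat x t))
  have hS : 0 < deviation x t m := by linarith
  have hSV : √(2 * VHat x t) ≤ deviation x t m := by
    have := sqrt_le_sqrt (le_mul_of_one_le_left (mul_nonneg zero_le_two hV) hu1)
    linarith
  have hUL := U_lt_log_wealthStar hδ hx hm hU (by linarith)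
  have hL := (one_le_U hδ).trans hUL.le
  rcases lt_or_ge |betaStar x t m| (9 / 20) with hb | hb
  · linarith [log_wealthStar_le_U_of_small_bet hδ hx hm hS hacc hSV hL hb]
  · rcases log_wealthStar_le_U_or_deviation_le hδ hx hm hS hacc hSV hL hb with hle | hle <;>
      linarith

theorem upper_le_mUp (ht : 1 ≤ t) : upper δ x t ≤ mUp δ x t := by
  obtain ⟨s, rfl⟩ := Nat.exists_eq_add_of_le' ht
  exact min_le_left _ _

theorem mLow_le_lower (ht : 1 ≤ t) : mLow δ x t ≤ lower δ x t := by
  obtain ⟨s, rfl⟩ := Nat.exists_eq_add_of_le' ht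
  exact le_max_left _ _

theorem half_width_le (hδ : δ ∈ Ioo (0 : ℝ) 1) (ht : 1 ≤ t) (hx : ∀ i, x i ∈ Icc (0 : ℝ) 1)
    {r : ℝ} (hr : ∀ m ∈ Icc (0 : ℝ) 1, m ∈ accepted δ x t → |muHat x t - m| ≤ r) :
    upper δ x t - muHat x t ≤ r ∧ muHat x t - lower δ x t ≤ r := by
  have hacc := muHat_mem_accepted (t := t) hδ hx
  have hmem := muHat_mem_Icc hx t
  constructor
  · have hUp : mUp δ x t ≤ muHat x t + r :=
      csSup_le ⟨_, left_mem_Icc.2 hmem.2, hacc⟩ fun m hm => by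
        linarith [(abs_le.1 (hr m ⟨hmem.1.trans hm.1.1, hm.1.2⟩ hm.2)).1]
    linarith [upper_le_mUp (δ := δ) (x := x) ht]
  · have hLow : muHat x t - r ≤ mLow δ x t :=
      le_csInf ⟨_, right_mem_Icc.2 hmem.1, hacc⟩ fun m hm => by
        linarith [(abs_le.1 (hr m ⟨hm.1.1, hm.1.2.trans hmem.2⟩ hm.2)).2]
    linarith [mLow_le_lower (δ := δ) (x := x) ht]

end Width

/-! ### Growth of `U` -/

section Growth

variable {x : ℕ → ℝ} {t : ℕ} {δ : ℝ}

theorem VHat_le (hx : ∀ i, x i ∈ Icc (0 : ℝ) 1) : VHat x t ≤ t :=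
  calc VHat x t = ∑ i ∈ Finset.range t, (x i - muHat x t) ^ 2 := rfl
    _ ≤ ∑ i ∈ Finset.range t, 1 := Finset.sum_le_sum fun i _ =>
        (sq_le_one_iff_abs_le_one _).2 (abs_sub_le_one hx (muHat_mem_Icc hx t) i)
    _ = t := by simp

/-- The number `c / y` at the argument `y = 1 / (2 + √(V_t / 2))` of `h` in `U_t`. -/
noncomputable def UScale (x : ℕ → ℝ) (t : ℕ) : ℝ := c * (2 + √(VHat x t / 2))

theorem UScale_eq (x : ℕ → ℝ) (t : ℕ) : UScale x t = c / (1 / (2 + √(VHat x t / 2))) := by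
  rw [UScale, div_div_eq_mul_div, div_one]

theorem UScale_pos : 0 < UScale x t :=
  mul_pos c_pos (by positivity)

theorem UScale_le {y : ℝ} (hy : √(VHat x t / 2) ≤ y) : UScale x t ≤ 18 * (2 + y) := by
  have hc : c ≤ 18 := by
    unfold c
    linarith [exp_one_lt_d9]
  unfold UScale
  gcongr

theorem log_UScale_pos : 0 < log (UScale x t) := by
  rw [UScale_eq]
  exact log_c_div_pos (one_div_two_add_sqrt_mem_Ioc _)

theorem log_log_UScale_pos : 0 < log (log (UScale x t)) := by
  rw [UScale_eq]
  exact log_log_c_div_pos (one_div_two_add_sqrt_mem_Ioc _)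

theorem UFactor_le (hδ : 0 < δ) {a b : ℝ} (ha : log (UScale x t) ≤ a)
    (hb : log (log (UScale x t)) ≤ b) : UFactor δ x t ≤ 40 / (3 * δ) * (a * b ^ 2) := by
  have hpos := log_UScale_pos (x := x) (t := t)
  have hpos' := log_log_UScale_pos (x := x) (t := t)
  have ha0 : 0 ≤ a := hpos.le.trans ha
  have hc : 2 / log (log c) ≤ 2 := by
    rw [div_le_iff₀ log_log_c_pos]
    linarith [le_log_log_c]
  rw [UFactor, h, ← UScale_eq]
  calc _ ≤ 20 / (3 * δ) * (2 * a * b ^ 2) := by gcongr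
    _ = _ := by ring

theorem log_UScale_le (hx : ∀ i, x i ∈ Icc (0 : ℝ) 1) (ht : 16 ≤ t) :
    log (UScale x t) ≤ 2 * log t := by
  have ht16 : (16 : ℝ) ≤ t := by exact_mod_cast ht
  have hsqrt : √(VHat x t / 2) ≤ √t :=
    sqrt_le_sqrt (by linarith [VHat_le (t := t) hx, VHat_nonneg (x := x) (t := t)])
  have hfour : 4 ≤ √(t : ℝ) := le_sqrt_of_sq_le (by linarith)
  have hle : UScale x t ≤ (t : ℝ) ^ 2 := by
    nlinarith [UScale_le hsqrt, sq_sqrt t.cast_nonneg]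
  calc log (UScale x t) ≤ log ((t : ℝ) ^ 2) := log_le_log UScale_pos hle
    _ = 2 * log t := by rw [log_pow, Nat.cast_ofNat]

theorem log_UScale_le_of_exp_one_lt (hV : exp 1 < VHat x t) :
    log (UScale x t) ≤ 5 * log (VHat x t) := by
  have hV0 := (exp_pos 1).trans hV
  have hV1 : 1 ≤ VHat x t := by linarith [exp_one_gt_d9]
  have hlog : 1 < log (VHat x t) := (lt_log_iff_exp_lt hV0).2 hV
  have hsqrt : √(VHat x t / 2) ≤ VHat x t := sqrt_le_iff.2 ⟨hV0.le, by nlinarith⟩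
  have hexp : (54 : ℝ) ≤ exp 4 :=
    calc (54 : ℝ) ≤ 2.718 ^ 4 := by norm_num
      _ ≤ exp 1 ^ 4 := by
          gcongr
          linarith [exp_one_gt_d9]
      _ = exp 4 := by rw [← exp_nat_mul, Nat.cast_ofNat, mul_one]
  calc log (UScale x t) ≤ log (exp 4 * VHat x t) :=
        log_le_log UScale_pos (by nlinarith [UScale_le hsqrt])
    _ = 4 + log (VHat x t) := by rw [log_mul (exp_ne_zero _) hV0.ne', log_exp]
    _ ≤ 5 * log (VHat x t) := by linarith

theorem two_le_log (ht : 16 ≤ t) : 2 ≤ log t := by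
  have ht16 : ((2 : ℝ) ^ 4) ≤ t := by exact_mod_cast ht
  have hle := log_le_log (by norm_num) ht16
  rw [log_pow, Nat.cast_ofNat] at hle
  linarith [log_two_gt_d9]

theorem one_le_log_cube_div (hδ : δ ∈ Ioo (0 : ℝ) 1) (ht : 16 ≤ t) :
    1 ≤ log (log t ^ 3 / δ) := by
  have hδ0 := hδ.1
  have hcube : (2 : ℝ) ^ 3 ≤ log t ^ 3 := pow_le_pow_left₀ (by norm_num) (two_le_log ht) 3
  have : 0 < log t ^ 3 := by linarith
  rw [le_log_iff_exp_le (by positivity), le_div_iff₀ hδ0]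
  nlinarith [exp_one_lt_d9, hδ.2]

theorem U_le_log_cube (hδ : δ ∈ Ioo (0 : ℝ) 1) (hx : ∀ i, x i ∈ Icc (0 : ℝ) 1) (ht : 16 ≤ t) :
    U δ x t ≤ (2 * log (320 / 3) + 2) * log (log t ^ 3 / δ) := by
  have hδ0 := hδ.1
  have hlogt := two_le_log ht
  have hscale := log_UScale_le hx ht
  have hfactor : UFactor δ x t ≤ 320 / 3 * (log t ^ 3 / δ) :=
    calc UFactor δ x t ≤ 40 / (3 * δ) * (2 * log t * (2 * log t) ^ 2) :=
          UFactor_le hδ0 hscale ((log_le_self log_UScale_pos.le).trans hscale)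
      _ = 320 / 3 * (log t ^ 3 / δ) := by
          field_simp
          ring
  have hlog := log_le_log (UFactor_pos hδ) hfactor
  rw [log_mul (by norm_num) (by positivity)] at hlog
  have hconst : 0 ≤ log (320 / 3 : ℝ) := log_nonneg (by norm_num)
  rw [U_eq_expSqrtRoot]
  nlinarith [expSqrtRoot_le (exp_one_le_UFactor hδ (x := x) (t := t)), one_le_log_cube_div hδ ht]

theorem U_le_log_log (hδ : δ ∈ Ioo (0 : ℝ) 1) (hx : ∀ i, x i ∈ Icc (0 : ℝ) 1) (ht : 16 ≤ t)
    (hs : 1 ≤ log (log t)) (hV : exp 1 < VHat x t) :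
    U δ x t ≤ log (log (VHat x t) / δ) + log (800 / 3) + 2 * log (log (log t))
      + 1 / 2 * log (U δ x t) := by
  have hδ0 := hδ.1
  have hlogV : 0 < log (VHat x t) :=
    zero_lt_one.trans ((lt_log_iff_exp_lt ((exp_pos 1).trans hV)).2 hV)
  have hloglog : log (log (UScale x t)) ≤ 2 * log (log t) := by
    have hle := log_le_log log_UScale_pos (log_UScale_le hx ht)
    rw [log_mul two_ne_zero (by linarith [two_le_log ht])] at hle
    linarith [log_two_lt_d9]
  have hfactor : UFactor δ x t ≤ log (VHat x t) / δ * (800 / 3 * log (log t) ^ 2) :=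
    calc UFactor δ x t ≤ 40 / (3 * δ) * (5 * log (VHat x t) * (2 * log (log t)) ^ 2) :=
          UFactor_le hδ0 (log_UScale_le_of_exp_one_lt hV) hloglog
      _ = _ := by
          field_simp
          ring
  have : 0 < log (log t) := zero_lt_one.trans_le hs
  have hlog := log_le_log (UFactor_pos hδ) hfactor
  rw [log_mul (by positivity) (by positivity), log_mul (by norm_num) (by positivity), log_pow,
    Nat.cast_ofNat] at hlog
  have hroot := expSqrtRoot_eq (exp_one_le_UFactor hδ (x := x) (t := t))
  rw [← U_eq_expSqrtRoot] at hroot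
  linarith

end Growth

/-! ### Law of the iterated logarithm -/

section IteratedLogarithm

variable {x : ℕ → ℝ} {t : ℕ} {δ : ℝ}

theorem two_mul_U_lt (hδ : δ ∈ Ioo (0 : ℝ) 1) (hU : 4 * U δ x t ≤ t) : 2 * U δ x t < t := by
  linarith [one_le_U (x := x) (t := t) hδ]

theorem inflatedU_le_two_mul (hδ : δ ∈ Ioo (0 : ℝ) 1) (hU : 4 * U δ x t ≤ t) :
    inflatedU δ x t ≤ 2 * U δ x t := by
  have hlt := two_mul_U_lt hδ hU
  have hU1 := one_le_U (x := x) (t := t) hδ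
  have hhalf : 2 * U δ x t / t ≤ 1 / 2 := by
    rw [div_le_div_iff₀ (natCast_pos_of_two_mul_U_lt hδ hlt) two_pos]
    linarith
  rw [inflatedU, div_le_iff₀ (one_sub_two_mul_U_div_pos hδ hlt)]
  nlinarith

theorem inflatedU_le_add_sq (hδ : δ ∈ Ioo (0 : ℝ) 1) (hU : 4 * U δ x t ≤ t) :
    inflatedU δ x t ≤ U δ x t + 4 * U δ x t ^ 2 / t := by
  have hlt := two_mul_U_lt hδ hU
  have hU1 := one_le_U (x := x) (t := t) hδ
  calc inflatedU δ x t
      = U δ x t + inflatedU δ x t * (2 * U δ x t / t) := by linarith [inflatedU_mul hδ hlt]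
    _ ≤ U δ x t + 2 * U δ x t * (2 * U δ x t / t) := by
        gcongr
        exact inflatedU_le_two_mul hδ hU
    _ = U δ x t + 4 * U δ x t ^ 2 / t := by ring

theorem lilWidth_nonneg : 0 ≤ lilWidth δ x t := by
  unfold lilWidth
  split_ifs <;> positivity

theorem sqrt_add_le_sqrt_add_sqrt {y z : ℝ} (hy : 0 ≤ y) (hz : 0 ≤ z) :
    √(y + z) ≤ √y + √z := by
  rw [sqrt_le_iff]
  refine ⟨by positivity, ?_⟩
  nlinarith [sq_sqrt hy, sq_sqrt hz, mul_nonneg (sqrt_nonneg y) (sqrt_nonneg z)]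

theorem sqrt_mul_VHat_div_le_of_exp_one_lt (hδ : δ ∈ Ioo (0 : ℝ) 1)
    (hx : ∀ i, x i ∈ Icc (0 : ℝ) 1) (hV : exp 1 < VHat x t) {u D : ℝ} (hD : 0 ≤ D)
    (hu : u ≤ log (log (VHat x t) / δ) + D) :
    √(u * (2 * VHat x t)) / t ≤ lilWidth δ x t + √(2 * D / t) := by
  have hV0 := (exp_pos 1).trans hV
  have hVt := VHat_le (t := t) hx
  have ht : (0 : ℝ) < t := hV0.trans_le hVt
  have hlog : 0 ≤ log (log (VHat x t) / δ) := by
    refine log_nonneg ((one_le_div hδ.1).2 (hδ.2.le.trans ?_))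
    exact ((lt_log_iff_exp_lt hV0).2 hV).le
  have hsqrt : √(2 * D * t) / t = √(2 * D / t) := by
    rw [show 2 * D / (t : ℝ) = 2 * D * t / t ^ 2 by field_simp, sqrt_div' _ (sq_nonneg _),
      sqrt_sq ht.le]
  rw [lilWidth, if_pos hV, ← hsqrt, ← add_div]
  gcongr
  calc √(u * (2 * VHat x t))
      ≤ √(2 * VHat x t * log (log (VHat x t) / δ) + 2 * D * t) := sqrt_le_sqrt (by nlinarith)
    _ ≤ _ := sqrt_add_le_sqrt_add_sqrt (by positivity) (by positivity)

theorem sqrt_mul_VHat_div_le_of_le_exp_one (hV : VHat x t ≤ exp 1) {u a s : ℝ} (ha : 0 ≤ a)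
    (hs : 1 ≤ s) (hu : u ≤ a * s) :
    √(u * (2 * VHat x t)) / t ≤ √(2 * a * exp 1) * (s / t) := by
  have hV0 := VHat_nonneg (x := x) (t := t)
  rw [mul_div_assoc']
  gcongr
  calc √(u * (2 * VHat x t)) ≤ √(2 * a * exp 1 * s ^ 2) := by
        refine sqrt_le_sqrt ?_
        calc u * (2 * VHat x t) ≤ a * s * (2 * exp 1) := by gcongr
          _ = 2 * a * exp 1 * (s * 1) := by ring
          _ ≤ 2 * a * exp 1 * (s * s) := by gcongr
          _ = 2 * a * exp 1 * s ^ 2 := by rw [sq]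
    _ = √(2 * a * exp 1) * s := by
        rw [sqrt_mul (by positivity), sqrt_sq (zero_le_one.trans hs)]

theorem inflatedU_le_log_log_add (hδ : δ ∈ Ioo (0 : ℝ) 1) (hx : ∀ i, x i ∈ Icc (0 : ℝ) 1)
    (ht : 16 ≤ t) (hs : 1 ≤ log (log t)) (hV : exp 1 < VHat x t) {C : ℝ} (hC : 1 ≤ C)
    (hU : U δ x t ≤ C * log (log t)) (hCt : 4 * (C * log (log t)) ≤ t)
    (hst : log (log t) ^ 2 ≤ t) :
    inflatedU δ x t ≤ log (log (VHat x t) / δ)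
      + (log (800 / 3) + C + 4 * C ^ 2 + 3 * log (log (log t))) := by
  have hU1 := one_le_U (x := x) (t := t) hδ
  have hinflated := inflatedU_le_add_sq hδ ((mul_le_mul_of_nonneg_left hU zero_le_four).trans hCt)
  have hsq : 4 * U δ x t ^ 2 / t ≤ 4 * C ^ 2 := by
    rw [div_le_iff₀ (by positivity)]
    calc 4 * U δ x t ^ 2 ≤ 4 * (C * log (log t)) ^ 2 := by gcongr
      _ = 4 * C ^ 2 * log (log t) ^ 2 := by ring
      _ ≤ 4 * C ^ 2 * t := by gcongr
  have hlogU : 1 / 2 * log (U δ x t) ≤ C + log (log (log t)) := by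
    have hle := log_le_log (zero_lt_one.trans_le hU1) hU
    rw [log_mul (by linarith) (by linarith)] at hle
    linarith [log_le_self (zero_le_one.trans hC), log_nonneg hs]
  linarith [U_le_log_log hδ hx ht hs hV]

/-- The error term in the law of the iterated logarithm: `A` bounds the excess of the inflated `U_t`
over `ln (ln V_t / δ)` up to a triple logarithm, and `B` collects the terms of order
`ln ln t / t`. -/
noncomputable def lilRemainder (A B : ℝ) (t : ℕ) : ℝ :=
  √(2 * (A + 3 * log (log (log t))) / t) + B * (log (log t) / t)

theorem widthBound_le_lilWidth_add (hδ : δ ∈ Ioo (0 : ℝ) 1) (hx : ∀ i, x i ∈ Icc (0 : ℝ) 1)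
    (ht : 16 ≤ t) (hs : 1 ≤ log (log t)) {C : ℝ} (hC : 1 ≤ C)
    (hU : U δ x t ≤ C * log (log t)) (hCt : 4 * (C * log (log t)) ≤ t)
    (hst : log (log t) ^ 2 ≤ t) :
    widthBound δ x t ≤ lilWidth δ x t + lilRemainder (log (800 / 3) + C + 4 * C ^ 2)
      (√(2 * (2 * C) * exp 1) + 8 / 3 * C + 24 * log (7 / (6 * δ))) t := by
  have ht0 : (0 : ℝ) < t := by positivity
  have hU4 : 4 * U δ x t ≤ t := by linarith
  have hinflated : inflatedU δ x t ≤ 2 * C * log (log t) := by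
    linarith [inflatedU_le_two_mul hδ hU4]
  have hlogs := log_nonneg hs
  have hmiddle : 4 / 3 * inflatedU δ x t / t ≤ 8 / 3 * C * (log (log t) / t) := by
    rw [mul_div_assoc', div_le_div_iff_of_pos_right ht0]
    linarith
  have hlast : 24 * log (7 / (6 * δ)) / t ≤ 24 * log (7 / (6 * δ)) * (log (log t) / t) := by
    have hpos := log_seven_div_pos hδ
    rw [mul_div_assoc', div_le_div_iff_of_pos_right ht0]
    exact le_mul_of_one_le_right (by positivity) hs
  have hroot : √(inflatedU δ x t * (2 * VHat x t)) / t ≤ lilWidth δ x t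
      + √(2 * (log (800 / 3) + C + 4 * C ^ 2 + 3 * log (log (log t))) / t)
      + √(2 * (2 * C) * exp 1) * (log (log t) / t) := by
    rcases lt_or_ge (exp 1) (VHat x t) with hV | hV
    · refine (sqrt_mul_VHat_div_le_of_exp_one_lt hδ hx hV ?_
        (inflatedU_le_log_log_add hδ hx ht hs hV hC hU hCt hst)).trans
        (le_add_of_nonneg_right (by positivity))
      have : 0 ≤ log (800 / 3 : ℝ) := log_nonneg (by norm_num)
      positivity
    · refine (sqrt_mul_VHat_div_le_of_le_exp_one hV (by linarith) hs hinflated).trans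
        (le_add_of_nonneg_left (add_nonneg lilWidth_nonneg (sqrt_nonneg _)))
  rw [widthBound_eq hδ (two_mul_U_lt hδ hU4), add_div, add_div, lilRemainder]
  linarith

theorem tendsto_log_log : Tendsto (fun t : ℕ => log (log t)) atTop atTop :=
  tendsto_log_atTop.comp (tendsto_log_atTop.comp tendsto_natCast_atTop_atTop)

theorem tendsto_log_log_sq_div :
    Tendsto (fun t : ℕ => log (log t) ^ 2 / t) atTop (nhds 0) := by
  have hlog : (fun t : ℕ => log (t : ℝ) ^ 2) =o[atTop] fun t : ℕ => (t : ℝ) :=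
    (isLittleO_pow_log_id_atTop (n := 2)).comp_tendsto tendsto_natCast_atTop_atTop
  refine squeeze_zero' (Eventually.of_forall fun t => by positivity) ?_ hlog.tendsto_div_nhds_zero
  filter_upwards [eventually_ge_atTop 16, tendsto_log_log.eventually_ge_atTop 0] with t ht hs
  have hle : log (log t) ≤ log t := log_le_self (by linarith [two_le_log ht])
  gcongr

theorem tendsto_log_log_div : Tendsto (fun t : ℕ => log (log t) / t) atTop (nhds 0) := by
  refine squeeze_zero' ?_ ?_ tendsto_log_log_sq_div
  · filter_upwards [tendsto_log_log.eventually_ge_atTop 0] with t hs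
    positivity
  · filter_upwards [tendsto_log_log.eventually_ge_atTop 1] with t hs
    gcongr
    exact le_self_pow₀ hs two_ne_zero

theorem eventually_log_log_div_pos : ∀ᶠ t : ℕ in atTop, 0 < log (log t) / t := by
  filter_upwards [tendsto_log_log.eventually_gt_atTop 0, eventually_gt_atTop 0] with t hs ht
  positivity

theorem isLittleO_sqrt_log_log_log_div (A : ℝ) :
    (fun t : ℕ => √(2 * (A + 3 * log (log (log t))) / t)) =o[atTop]
      fun t : ℕ => √(log (log t) / t) := by
  refine IsLittleO.sqrt (isLittleO_of_tendsto'
    (eventually_log_log_div_pos.mono fun t ht h0 => absurd h0 ht.ne') ?_)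
    (eventually_log_log_div_pos.mono fun t ht => ht.le)
  have hlimit : Tendsto (fun s : ℝ => 2 * A * s⁻¹ + 6 * (log s / s)) atTop (nhds 0) := by
    simpa using (tendsto_inv_atTop_zero.const_mul (2 * A)).add
      (isLittleO_log_id_atTop.tendsto_div_nhds_zero.const_mul 6)
  refine (hlimit.comp tendsto_log_log).congr' ?_
  filter_upwards [tendsto_log_log.eventually_gt_atTop 0, eventually_gt_atTop 0] with t hs ht
  simp only [Function.comp_apply]
  field_simp
  ring

theorem isLittleO_log_log_div :
    (fun t : ℕ => log (log t) / t) =o[atTop] fun t : ℕ => √(log (log t) / t) := by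
  refine isLittleO_of_tendsto'
    (eventually_log_log_div_pos.mono fun t ht h0 => absurd h0 (sqrt_pos.2 ht).ne') ?_
  have hsqrt := (continuous_sqrt.tendsto 0).comp tendsto_log_log_div
  rw [sqrt_zero] at hsqrt
  exact hsqrt.congr fun t => div_sqrt.symm

theorem isLittleO_lilRemainder (A B : ℝ) :
    lilRemainder A B =o[atTop] fun t : ℕ => √(log (log t) / t) :=
  (isLittleO_sqrt_log_log_log_div A).add (isLittleO_log_log_div.const_mul_left B)

theorem U_le_mul_log_log (hδ : δ ∈ Ioo (0 : ℝ) 1) (hx : ∀ i, x i ∈ Icc (0 : ℝ) 1) (ht : 16 ≤ t)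
    (hδt : log (1 / δ) ≤ log (log t)) :
    U δ x t ≤ (2 * log (320 / 3) + 2) * 4 * log (log t) := by
  have hlogt := two_le_log ht
  have hconst : 0 ≤ log (320 / 3 : ℝ) := log_nonneg (by norm_num)
  have hcube : log (log t ^ 3 / δ) ≤ 4 * log (log t) := by
    rw [one_div, log_inv] at hδt
    rw [log_div (by positivity) hδ.1.ne', log_pow, Nat.cast_ofNat]
    linarith
  rw [mul_assoc]
  exact (U_le_log_cube hδ hx ht).trans (by gcongr)

theorem eventually_log_log_large (δ C : ℝ) :
    ∀ᶠ t : ℕ in atTop, 16 ≤ t ∧ 1 ≤ log (log t) ∧ log (1 / δ) ≤ log (log t) ∧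
      4 * (C * log (log t)) ≤ t ∧ log (log t) ^ 2 ≤ t := by
  filter_upwards [eventually_ge_atTop 16, tendsto_log_log.eventually_ge_atTop 1,
    tendsto_log_log.eventually_ge_atTop (log (1 / δ)),
    (tendsto_log_log_div.const_mul (4 * C)).eventually_le_const
      (show 4 * C * 0 < 1 by norm_num),
    tendsto_log_log_sq_div.eventually_le_const one_pos] with t ht hs hδt hCt hst
  have ht0 : (0 : ℝ) < t := by positivity
  rw [mul_div_assoc', div_le_one ht0] at hCt
  exact ⟨ht, hs, hδt, by linarith, (div_le_one ht0).1 hst⟩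

theorem eventually_abs_sub_le_lilWidth_add (hδ : δ ∈ Ioo (0 : ℝ) 1) :
    ∃ A B, ∀ᶠ t : ℕ in atTop, ∀ x : ℕ → ℝ, (∀ i, x i ∈ Icc (0 : ℝ) 1) →
      ∀ m ∈ Icc (0 : ℝ) 1, m ∈ accepted δ x t →
        |muHat x t - m| ≤ lilWidth δ x t + lilRemainder A B t := by
  set C := (2 * log (320 / 3) + 2) * 4
  have hconst : 0 ≤ log (320 / 3 : ℝ) := log_nonneg (by norm_num)
  have hC : 1 ≤ C := by linarith
  refine ⟨log (800 / 3) + C + 4 * C ^ 2,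
    √(2 * (2 * C) * exp 1) + 8 / 3 * C + 24 * log (7 / (6 * δ)),
    (eventually_log_log_large δ C).mono fun t ⟨ht, hs, hδt, hCt, hst⟩ x hx m hm hacc => ?_⟩
  have hU := U_le_mul_log_log hδ hx ht hδt
  have hU2 : 2 * U δ x t < t := two_mul_U_lt hδ (by linarith)
  exact (width_of_accepted hδ hx hm hU2 hacc).trans
    (widthBound_le_lilWidth_add hδ hx ht hs hC hU hCt hst)

theorem exists_lil_remainder (hδ : δ ∈ Ioo (0 : ℝ) 1) :
    ∃ ε : ℕ → ℝ, ε =o[atTop] (fun t : ℕ => √(log (log t) / t)) ∧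
      ∀ x : ℕ → ℝ, (∀ i, x i ∈ Icc (0 : ℝ) 1) → ∀ t : ℕ, 1 ≤ t →
        upper δ x t - muHat x t ≤ lilWidth δ x t + ε t ∧
        muHat x t - lower δ x t ≤ lilWidth δ x t + ε t := by
  obtain ⟨A, B, hAB⟩ := eventually_abs_sub_le_lilWidth_add hδ
  obtain ⟨T, hT⟩ := eventually_atTop.1 hAB
  refine ⟨fun t => if T ≤ t then lilRemainder A B t else 1,
    (isLittleO_lilRemainder A B).congr' ?_ EventuallyEq.rfl, fun x hx t ht =>
      half_width_le hδ ht hx fun m hm hacc => ?_⟩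
  · filter_upwards [eventually_ge_atTop T] with t ht
    rw [if_pos ht]
  · dsimp only
    split_ifs with hTt
    · exact hT t hTt x hx m hm hacc
    · have hmu := muHat_mem_Icc hx t
      have hlil := lilWidth_nonneg (δ := δ) (x := x) (t := t)
      exact abs_le.2 ⟨by linarith [hm.2, hmu.1], by linarith [hm.1, hmu.2]⟩

end IteratedLogarithm

end PreciseR70

theorem theorem7 :
    -- regret of the mixture strategy, for every sequence of outcomes
    (∀ x : ℕ → ℝ, (∀ i, x i ∈ Set.Icc (0 : ℝ) 1) → ∀ t : ℕ, 1 ≤ t → ∀ m ∈ Set.Icc (0 : ℝ) 1,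
      (PreciseR70.regret x t m : EReal) ≤ ENNReal.log (PreciseR70.R x t m)) ∧
    -- time-uniform coverage with probability at least `1 - δ`
    (∀ δ ∈ Set.Ioo (0 : ℝ) 1, ∀ (Ω : Type*) [MeasurableSpace Ω] (P : Measure Ω)
      [IsProbabilityMeasure P] (X : ℕ → Ω → ℝ) (μ : ℝ),
      (∀ i, Measurable (X i)) →
      (∀ i, ∀ᵐ ω ∂P, X i ω ∈ Set.Icc (0 : ℝ) 1) →
      (∀ i, P[X i | ⨆ j < i, MeasurableSpace.comap (X j) inferInstance] =ᵐ[P] fun _ => μ) →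
      P {ω | ¬ ∀ t : ℕ, 1 ≤ t → μ ∈ Set.Icc (PreciseR70.lower δ (fun i => X i ω) t)
          (PreciseR70.upper δ (fun i => X i ω) t)} ≤ ENNReal.ofReal δ) ∧
    -- explicit half-width bound
    (∀ δ ∈ Set.Ioo (0 : ℝ) 1, ∀ x : ℕ → ℝ, (∀ i, x i ∈ Set.Icc (0 : ℝ) 1) → ∀ t : ℕ, 1 ≤ t →
      2 * PreciseR70.U δ x t < t →
      PreciseR70.upper δ x t - PreciseR70.muHat x t ≤ PreciseR70.widthBound δ x t ∧
      PreciseR70.muHat x t - PreciseR70.lower δ x t ≤ PreciseR70.widthBound δ x t) ∧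
    -- `U_t = O(ln (ln³ t / δ))`, uniformly in `δ` and in the sequence
    (∃ K : ℝ, ∃ t₀ : ℕ, ∀ δ ∈ Set.Ioo (0 : ℝ) 1, ∀ x : ℕ → ℝ, (∀ i, x i ∈ Set.Icc (0 : ℝ) 1) →
      ∀ t : ℕ, t₀ ≤ t → |PreciseR70.U δ x t| ≤ K * Real.log (Real.log t ^ 3 / δ)) ∧
    -- law of the iterated logarithm, uniformly in the sequence
    (∀ δ ∈ Set.Ioo (0 : ℝ) 1, ∃ ε : ℕ → ℝ,
      ε =o[atTop] (fun t : ℕ => √(Real.log (Real.log t) / t)) ∧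
      ∀ x : ℕ → ℝ, (∀ i, x i ∈ Set.Icc (0 : ℝ) 1) → ∀ t : ℕ, 1 ≤ t →
        PreciseR70.upper δ x t - PreciseR70.muHat x t ≤ PreciseR70.lilWidth δ x t + ε t ∧
        PreciseR70.muHat x t - PreciseR70.lower δ x t ≤ PreciseR70.lilWidth δ x t + ε t) := by
  refine ⟨fun x hx t _ m hm => PreciseR70.regret_le_log_R hx hm,
    fun δ hδ Ω _ P _ X μ hX hX01 hcond =>
      (measure_mono fun ω hω => ?_).trans (PreciseR70.coverage hδ hX hX01 hcond),
    fun δ hδ x hx t ht hU => PreciseR70.half_width_le hδ ht hx fun m hm hacc =>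
      PreciseR70.width_of_accepted hδ hx hm hU hacc,
    ⟨2 * Real.log (320 / 3) + 2, 16, fun δ hδ x hx t ht => ?_⟩,
    fun δ hδ => PreciseR70.exists_lil_remainder hδ⟩
  · obtain ⟨t, ht⟩ := not_forall.1 hω
    exact ⟨t, (Classical.not_imp.1 ht).2⟩
  · rw [abs_of_nonneg (zero_le_one.trans (PreciseR70.one_le_U hδ))]
    exact PreciseR70.U_le_log_cube hδ hx ht
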